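/- For $d\times d$ complex matrices let $D_{\mathrm{tr}}(\rho,\sigma)=\tfrac12\operatorname{tr}\sqrt{(\rho-\sigma)^\dagger(\rho-\sigma)}$. (i) Let $\rho$ be a $d\times d$ density matrix and $\tilde\rho$ a $d\times d$ matrix with $|\tilde\rho_{jk}-\rho_{jk}|\le\epsilon_1$ for all $j,k$, where $\epsilon_1\le 2\epsilon/d^{3/2}$. Then $D_{\mathrm{tr}}(\rho,\tilde\rho)\le\epsilon$. (ii) Let $d=2^n$ with $n\ge1$, and consider the following protocol (DMP-ST) on independent copies of an unknown $n$-qubit state $\rho$. On $N$ copies measure the computational basis and let $\tilde\rho_{jj}$ be the relative frequency of the outcome $j$. On each of $(2K+1)m$ further copies, draw a random unitary $U$, measure $U\rho U^\dagger$ in the computational basis, and from the outcome $b$ form the snapshot $\hat\rho=\mathcal M^{-1}(U^\dagger|b\rangle\langle b|U)$, where either - (random Clifford) $U$ is uniform on the $n$-qubit Clifford group modulo phases and $\mathcal M^{-1}(X)=(d+1)X-\operatorname{tr}(X)I$; or - (biased MUB) $U_0=I,U_1,\dots,U_d$ are unitaries whose bases $\{U_j^\dagger|k\rangle\}_k$ form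 a complete set of mutually unbiased bases, $U=U_0$ with probability $\tfrac12$ and $U=U_j$ with probability $\tfrac1{2d}$ for each $1\le j\le d$, and $\mathcal M^{-1}(X)=2d\big[X-\tfrac{d-1}{d}\sum_k\operatorname{tr}(X|k\rangle\langle k|)\,|k\rangle\langle k|\big]-\tfrac{\operatorname{tr}(X)}{d}I$. For $O=|v\rangle\langle v|$ let $\hat o(v)$ be the median, over $2K+1$ batches of $m$ snapshots, of the batch means of $\operatorname{tr}(O\hat\rho)$. For $j<k$ put $$\tilde\rho_{jk}=\hat o\Big(\tfrac{|j\rangle+|k\rangle}{\sqrt2}\Big)-i\,\hat o\Big(\tfrac{|j\rangle+i|k\rangle}{\sqrt2}\Big)-\tfrac{1-i}2\,(\tilde\rho_{jj}+\tilde\rho_{kk}),\qquad \tilde\rho_{kj}=\overline{\tilde\rho_{jk}} .$$ There is an absolute constant $C>0$ such that for all $n\ge1$, $d=2^n$, $0<\epsilon\le1$ and $0<\delta<1$ there are $N,K,m$ with $$N+(2K+1)m\ \le\ C\,\frac{d^3\log(d/\delta)}{\epsilon^2}$$ for which, for every $n$-qubit state $\rho$, with random Clifford measurements and also with biased MUB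 measurements for every complete set of mutually unbiased bases as above, with probability at least $1-\delta$ both $|\tilde\rho_{jk}-\rho_{jk}|\le 2\epsilon/d^{3/2}$ for all $j,k$ and $D_{\mathrm{tr}}(\rho,\tilde\rho)\le\epsilon$ hold. In particular, for each fixed $\delta\in(0,1)$, a total of $O(d^3\log d/\epsilon^2)$ copies suffices, with a constant depending only on $\delta$. -/

import Mathlib

open scoped ComplexOrder

noncomputable section

namespace DMPST

/-! ### States and trace distance -/

/-- A density matrix: positive semidefinite with unit trace. -/
def IsDensity {ι : Type*} [Fintype ι] (ρ : Matrix ι ι ℂ) : Prop :=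
  ρ.PosSemidef ∧ ρ.trace = 1

open scoped MatrixOrder in
/-- The trace distance `(1/2) tr √((ρ - σ)† (ρ - σ))`. -/
def traceDist {ι : Type*} [Fintype ι] [DecidableEq ι] (ρ σ : Matrix ι ι ℂ) : ℝ :=
  1 / 2 * (CFC.sqrt ((ρ - σ).conjTranspose * (ρ - σ))).trace.re

/-! ### Qubits -/

/-- Labels of the computational basis of `n` qubits. -/
abbrev Label (n : ℕ) : Type := Fin n → Fin 2

/-- Operators on `n` qubits. -/
abbrev Op (n : ℕ) : Type := Matrix (Label n) (Label n) ℂ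

/-- The dimension `d = 2 ^ n`, as a real number. -/
def dim (n : ℕ) : ℝ := 2 ^ n

/-- The projector `|b⟩⟨b|` on a computational basis vector. -/
def basisProj {n : ℕ} (b : Label n) : Op n := Matrix.single b b 1

/-- The total order on the labels: comparison of the numbers `0, …, 2 ^ n - 1` they encode. -/
def labelLT {n : ℕ} (j k : Label n) : Prop := finFunctionFinEquiv j < finFunctionFinEquiv k

instance {n : ℕ} (j k : Label n) : Decidable (labelLT j k) := by
  unfold labelLT; infer_instance

/-- The rank-one operator `|v⟩⟨v|`. -/
def ketBra {n : ℕ} (v : Label n → ℂ) : Op n := Matrix.vecMulVec v (star v)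

/-- The vector `(|j⟩ + |k⟩) / √2`. -/
def phiVec {n : ℕ} (j k : Label n) : Label n → ℂ :=
  ((Real.sqrt 2 : ℂ)⁻¹) • (Pi.single j 1 + Pi.single k 1)

/-- The vector `(|j⟩ + i |k⟩) / √2`. -/
def psiVec {n : ℕ} (j k : Label n) : Label n → ℂ :=
  ((Real.sqrt 2 : ℂ)⁻¹) • (Pi.single j 1 + Complex.I • Pi.single k 1)

/-! ### The Clifford group -/

/-- The Pauli matrices `I, X, Y, Z`. -/
def pauli1 : Fin 4 → Matrix (Fin 2) (Fin 2) ℂ :=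
  ![1, !![0, 1; 1, 0], !![0, -Complex.I; Complex.I, 0], !![1, 0; 0, -1]]

/-- The `n`-qubit Pauli operator `σ_{p 0} ⊗ ⋯ ⊗ σ_{p (n-1)}`. -/
def pauli {n : ℕ} (p : Fin n → Fin 4) : Op n :=
  Matrix.of fun j k => ∏ i, pauli1 (p i) (j i) (k i)

/-- `U` is a Clifford unitary: conjugation by `U` maps Pauli operators to signed Pauli operators. -/
def IsClifford {n : ℕ} (U : unitary (Op n)) : Prop :=
  ∀ p : Fin n → Fin 4, ∃ q : Fin n → Fin 4,
    (U : Op n) * pauli p * star (U : Op n) = pauli q ∨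
    (U : Op n) * pauli p * star (U : Op n) = -pauli q

/-- The Clifford group modulo global phases, as the group of maps `X ↦ U X U†`. -/
def Clifford (n : ℕ) : Type :=
  {α : Op n ≃⋆ₐ[ℂ] Op n //
    ∃ U : unitary (Op n), IsClifford U ∧ α = Unitary.conjStarAlgAut ℂ (Op n) U}

theorem single_eq_sum_pauli1 (a b : Fin 2) :
    ∃ c : Fin 4 → ℂ, ∀ x y : Fin 2,
      (if a = x ∧ b = y then (1 : ℂ) else 0) = ∑ p, c p * pauli1 p x y := by
  fin_cases a <;> fin_cases b
  · exact ⟨![1/2, 0, 0, 1/2], by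
      intro x y; fin_cases x <;> fin_cases y <;> simp [Fin.sum_univ_four, pauli1] <;> norm_num⟩
  · exact ⟨![0, 1/2, Complex.I/2, 0], by
      intro x y; fin_cases x <;> fin_cases y <;> simp [Fin.sum_univ_four, pauli1] <;>
        ring_nf <;> simp <;> norm_num⟩
  · exact ⟨![0, 1/2, -Complex.I/2, 0], by
      intro x y; fin_cases x <;> fin_cases y <;> simp [Fin.sum_univ_four, pauli1] <;>
        ring_nf <;> simp <;> norm_num⟩
  · exact ⟨![1/2, 0, 0, -1/2], by
      intro x y; fin_cases x <;> fin_cases y <;> simp [Fin.sum_univ_four, pauli1] <;> norm_num⟩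

/-- The Pauli operators span the matrix algebra. -/
theorem single_eq_sum_pauli {n : ℕ} (j k : Label n) :
    ∃ c : (Fin n → Fin 4) → ℂ, (Matrix.single j k 1 : Op n) = ∑ p, c p • pauli p := by
  choose c hc using fun i => single_eq_sum_pauli1 (j i) (k i)
  refine ⟨fun p => ∏ i, c i (p i), ?_⟩
  ext x y
  have h1 : (Matrix.single j k 1 : Op n) x y
      = ∏ i, (if j i = x i ∧ k i = y i then (1 : ℂ) else 0) := by
    rw [Matrix.single_apply, Finset.prod_ite_zero]
    simp [funext_iff, forall_and]
  rw [h1, Finset.prod_congr rfl fun i _ => hc i (x i) (y i), Finset.prod_univ_sum]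
  simp [Matrix.sum_apply, pauli, Finset.prod_mul_distrib]

instance (n : ℕ) : Finite (Clifford n) := by
  classical
  let s : (Fin n → Fin 4) × Bool → Op n := fun q => if q.2 then pauli q.1 else -pauli q.1
  have h : ∀ (α : Clifford n) (p : Fin n → Fin 4), ∃ q, α.1 (pauli p) = s q := by
    rintro ⟨α, U, hU, rfl⟩ p
    obtain ⟨q, hq | hq⟩ := hU p
    · exact ⟨(q, true), by simpa [s] using hq⟩
    · exact ⟨(q, false), by simpa [s] using hq⟩
  choose f hf using h
  refine Finite.of_injective f fun α β hαβ => ?_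
  have hp : ∀ p, α.1 (pauli p) = β.1 (pauli p) := fun p => by rw [hf, hf, hαβ]
  apply Subtype.ext
  ext1 X
  rw [Matrix.matrix_eq_sum_single X]
  simp only [map_sum]
  refine Finset.sum_congr rfl fun j _ => Finset.sum_congr rfl fun k _ => ?_
  obtain ⟨c, hc⟩ := single_eq_sum_pauli j k
  have : Matrix.single j k (X j k) = X j k • (Matrix.single j k 1 : Op n) := by simp
  rw [this, hc]
  simp [map_sum, map_smul, hp]

instance (n : ℕ) : Fintype (Clifford n) := Fintype.ofFinite _

instance (n : ℕ) : MeasurableSpace (Clifford n) := ⊤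

/-! ### Mutually unbiased bases -/

/-- The unitaries `U_0 = 1, U_1, …, U_{2^n}` describe a complete set of mutually unbiased bases
`B_j = {U_j† |k⟩ : k}` containing the computational basis `B_0`. -/
def IsCompleteMUB {n : ℕ} (U : Fin (2 ^ n + 1) → unitary (Op n)) : Prop :=
  U 0 = 1 ∧ ∀ j j', j ≠ j' → ∀ k l : Label n,
    ‖((U j : Op n) * star (U j' : Op n)) k l‖ ^ 2 = 1 / dim n

/-! ### Randomized measurements and classical shadows -/

/-- A randomized measurement: with probability `weight i` the state evolves by the unitary channel
`evolve i`, given by `X ↦ U_i X U_i†`, and is measured in the computational basis.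
`inv` is the linear map used to turn outcomes into snapshots. -/
structure Scheme (n : ℕ) (ι : Type) where
  weight : ι → ℝ
  evolve : ι → (Op n ≃⋆ₐ[ℂ] Op n)
  inv : Op n → Op n

/-- Random Clifford measurements, with `M⁻¹(X) = (2^n + 1) X - tr(X) I`. -/
def cliffordScheme (n : ℕ) : Scheme n (Clifford n) where
  weight _ := 1 / (Fintype.card (Clifford n) : ℝ)
  evolve α := α.1
  inv X := ((dim n : ℂ) + 1) • X - X.trace • (1 : Op n)

/-- Biased MUB measurements: the computational basis has probability `1/2`, each of the others
`1/2^(n+1)`, and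
`M⁻¹(X) = 2^(n+1) [X - (2^n - 1)/2^n ∑_k tr(X |k⟩⟨k|) |k⟩⟨k|] - tr(X) I / 2^n`. -/
def mubScheme {n : ℕ} (U : Fin (2 ^ n + 1) → unitary (Op n)) : Scheme n (Fin (2 ^ n + 1)) where
  weight j := if j = 0 then 1 / 2 else 1 / 2 ^ (n + 1)
  evolve j := Unitary.conjStarAlgAut ℂ (Op n) (U j)
  inv X := (2 * (dim n : ℂ)) •
      (X - (((dim n : ℂ) - 1) / (dim n : ℂ)) • ∑ k, (X * basisProj k).trace • basisProj k)
    - (X.trace / (dim n : ℂ)) • (1 : Op n)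

/-- Born's rule for one measurement of `ρ` in the computational basis. -/
def bornLaw {n : ℕ} (ρ : Op n) : MeasureTheory.Measure (Label n) :=
  ∑ b, ENNReal.ofReal (ρ b b).re • MeasureTheory.Measure.dirac b

/-- The law of one round of a randomized measurement of `ρ`: the random setting together with the
outcome. -/
def roundLaw {n : ℕ} {ι : Type} [Fintype ι] [MeasurableSpace ι] (S : Scheme n ι) (ρ : Op n) :
    MeasureTheory.Measure (ι × Label n) :=
  ∑ i, ∑ b, ENNReal.ofReal (S.weight i * (S.evolve i ρ b b).re) •
    MeasureTheory.Measure.dirac (i, b)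

/-- The snapshot `M⁻¹(U_i† |b⟩⟨b| U_i)`. -/
def snapshot {n : ℕ} {ι : Type} (S : Scheme n ι) (x : ι × Label n) : Op n :=
  S.inv ((S.evolve x.1).symm (basisProj x.2))

/-- The median of an odd number of reals. -/
def median {K : ℕ} (x : Fin (2 * K + 1) → ℝ) : ℝ := x (Tuple.sort x ⟨K, by omega⟩)

/-- The data recorded: `N` outcomes in the computational basis, and `2 K + 1` batches of `m` rounds
each of the randomized measurement. -/
abbrev Data (n : ℕ) (ι : Type) (N K m : ℕ) : Type :=
  (Fin N → Label n) × (Fin (2 * K + 1) → Fin m → ι × Label n)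

/-- The law of the data: all `N + (2 K + 1) m` copies of `ρ` are measured independently. -/
def dataLaw {n : ℕ} {ι : Type} [Fintype ι] [MeasurableSpace ι] (S : Scheme n ι) (ρ : Op n)
    (N K m : ℕ) : MeasureTheory.Measure (Data n ι N K m) :=
  (MeasureTheory.Measure.pi fun _ : Fin N => bornLaw ρ).prod
    (MeasureTheory.Measure.pi fun _ : Fin (2 * K + 1) =>
      MeasureTheory.Measure.pi fun _ : Fin m => roundLaw S ρ)

/-- The median-of-means estimate of `tr (O ρ)` from the classical shadow. -/
def shadowEstimate {n : ℕ} {ι : Type} {N K m : ℕ} (S : Scheme n ι) (O : Op n)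
    (x : Data n ι N K m) : ℝ :=
  median fun a => (∑ t, (O * snapshot S (x.2 a t)).trace.re) / (m : ℝ)

/-- The estimate of the diagonal element `ρ_jj`: the relative frequency of the outcome `j`. -/
def diagEstimate {n : ℕ} {ι : Type} {N K m : ℕ} (x : Data n ι N K m) (j : Label n) : ℝ :=
  (Finset.card {t : Fin N | x.1 t = j} : ℝ) / (N : ℝ)

/-- The estimate of `ρ_jk` for `j ≠ k`:
`tr(ρ |φ_jk⟩⟨φ_jk|) - i tr(ρ |ψ_jk⟩⟨ψ_jk|) - (1 - i)/2 (ρ_jj + ρ_kk)` with the expectation values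
replaced by their estimates. -/
def offDiagEstimate {n : ℕ} {ι : Type} {N K m : ℕ} (S : Scheme n ι) (x : Data n ι N K m)
    (j k : Label n) : ℂ :=
  (shadowEstimate S (ketBra (phiVec j k)) x : ℂ)
    - Complex.I * (shadowEstimate S (ketBra (psiVec j k)) x : ℂ)
    - (1 - Complex.I) / 2 * ((diagEstimate x j : ℂ) + (diagEstimate x k : ℂ))

/-- The estimate of the density matrix. The entries above the diagonal are estimated directly,
those below by Hermitian symmetry. -/
def estimate {n : ℕ} {ι : Type} {N K m : ℕ} (S : Scheme n ι) (x : Data n ι N K m) : Op n :=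
  Matrix.of fun j k =>
    if j = k then (diagEstimate x j : ℂ)
    else if labelLT j k then offDiagEstimate S x j k
    else star (offDiagEstimate S x k j)

/-- Tomography of every `n`-qubit state with the scheme `S` from `N + (2 K + 1) m` copies: with
probability at least `1 - δ` all entries are estimated to error `2 ε / d^(3/2)` and the trace
distance of the estimate to the state is at most `ε`. -/
def Succeeds {n : ℕ} {ι : Type} [Fintype ι] [MeasurableSpace ι] (S : Scheme n ι)
    (ε δ : ℝ) (N K m : ℕ) : Prop :=
  ∀ ρ : Op n, IsDensity ρ →
    ENNReal.ofReal (1 - δ) ≤ dataLaw S ρ N K m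
      {x | (∀ j k, ‖estimate S x j k - ρ j k‖ ≤ 2 * ε / dim n ^ (3 / 2 : ℝ)) ∧
        traceDist ρ (estimate S x) ≤ ε}

/-- Tomography succeeds with random Clifford measurements and also with biased measurements of any
complete set of mutually unbiased bases. -/
def TomographyFrom (n : ℕ) (ε δ : ℝ) (N K m : ℕ) : Prop :=
  Succeeds (cliffordScheme n) ε δ N K m ∧
    ∀ U : Fin (2 ^ n + 1) → unitary (Op n), IsCompleteMUB U →
      Succeeds (mubScheme U) ε δ N K m

end DMPST

end

/-!
The entrywise bound implies the trace-distance bound because `tr √(A† A) ≤ √d ‖A‖₂ ≤ d^(3/2) max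
|A_jk|` (`traceDist_le_of_entry_le`). By polarization an off-diagonal entry is a combination of
the expectation values of the two pair states `(|j⟩ + c |k⟩) / √2` with `c = 1, i` and of two
diagonal entries (`IsDensity.entry_eq`), so it is enough to know `d` frequencies and `2 d²`
expectation values to accuracy `η = ε / (2 d^(3/2))`. Hoeffding's inequality handles the
frequencies (`measure_mean_deviation_le_exp`). If the snapshots estimate the pair states without
bias and with a second moment bounded by a constant (`Scheme.IsShadow`), then `O(1 / η²)` of them
give a batch mean that is wrong with probability at most `1/16`, and the median of `2 K + 1` batch
means is wrong with probability at most `4^(-K)`, since `K + 1` independent batches have to fail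
(`measure_medianOfMeans_deviation_le`). The union bound is `Scheme.IsShadow.succeeds`; it costs `K
= O(log (d / δ))`.

It remains to bound the first two moments of the snapshots for the two measurement schemes.

*Random Clifford measurements.* A diagonal entry is a signed average of the values at the `d` diagonal Pauli
operators `Z`, so the moments are averages of functions of `α⁻¹ Z` over the Clifford group.
Conjugation by `(1 - i P) / √2` for a Pauli operator `P` is a symplectic transvection of the Pauli
labels, and composing with it permutes the Clifford group. Two transvections connect any two
nontrivial Pauli operators, which gives the exact second-order moment and unbiasedness
(`cliffordSum_single`, `sum_clifford_diag_mul_diag`). The second moment of a snapshot involves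
pairs of Pauli operators. The full 3-design property is not needed: a quarter of all transvections
fix one operator of a pair and move the other to distinct places, so the orbits of pairs have size
of order `d⁴` (`cliffordSum_pair_le`), and the Pauli expectation values of a pair state have `ℓ¹`
norm at most `2 d`, so that the average is bounded.

*Mutually unbiased bases.* The `d (d + 1)` basis vectors attain the Welch bound for the frame
potential, hence they form a 2-design (`sum_tensor_eq_of_framePotential`), which shows that the
map used for the snapshots inverts the measurement channel. Vectors of the bases other than the
computational one are flat, `|⟨x|ψ⟩|² = 1/d`, so snapshots of pair states are bounded even
pointwise (`IsCompleteMUB.abs_trace_mul_snapshot_le`).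
-/

noncomputable section

namespace DMPST

open MeasureTheory ProbabilityTheory

/-! ### Trace distance -/

/-- The squared Hilbert–Schmidt norm as a sum over entries. -/
theorem trace_conjTranspose_mul_self_re {ι : Type*} [Fintype ι] (A : Matrix ι ι ℂ) :
    (A.conjTranspose * A).trace.re = ∑ i, ∑ j, ‖A j i‖ ^ 2 := by
  simp only [Matrix.trace, Matrix.diag, Matrix.mul_apply, Matrix.conjTranspose_apply,
    Complex.re_sum]
  refine Finset.sum_congr rfl fun i _ => Finset.sum_congr rfl fun j _ => ?_
  rw [← Complex.normSq_eq_norm_sq, Complex.star_def, ← Complex.normSq_eq_conj_mul_self,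
    Complex.ofReal_re]

open scoped MatrixOrder in
/-- An entrywise error `c` costs at most `d^(3/2) c / 2` in trace distance: Cauchy–Schwarz on the
diagonal of `S = √(A† A)` gives `(tr S)² ≤ d tr S² = d tr (A† A)`. -/
theorem traceDist_le_of_entry_le {ι : Type*} [Fintype ι] [DecidableEq ι] (ρ σ : Matrix ι ι ℂ)
    {c : ℝ} (hc : 0 ≤ c) (h : ∀ j k, ‖σ j k - ρ j k‖ ≤ c) :
    traceDist ρ σ ≤ (Fintype.card ι : ℝ) ^ (3 / 2 : ℝ) * c / 2 := by
  unfold traceDist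
  set A := ρ - σ
  set S := CFC.sqrt (A.conjTranspose * A)
  have hpsd : (0 : Matrix ι ι ℂ) ≤ A.conjTranspose * A :=
    (Matrix.posSemidef_conjTranspose_mul_self A).nonneg
  have hSS : S * S = A.conjTranspose * A := CFC.sqrt_mul_sqrt_self _ hpsd
  have hSh : S.conjTranspose = S :=
    (Matrix.nonneg_iff_posSemidef.mp (CFC.sqrt_nonneg (A.conjTranspose * A))).isHermitian
  set d : ℝ := (Fintype.card ι : ℝ)
  have hd : 0 ≤ d := Nat.cast_nonneg _
  have h1 : S.trace.re ^ 2 ≤ d * ∑ i, (S i i).re ^ 2 := by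
    have := sq_sum_le_card_mul_sum_sq (s := (Finset.univ : Finset ι)) (f := fun i => (S i i).re)
    simpa [Matrix.trace, Complex.re_sum, d] using this
  have h2 : ∑ i, (S i i).re ^ 2 ≤ ∑ i, ∑ j, ‖S j i‖ ^ 2 := by
    refine Finset.sum_le_sum fun i _ => ?_
    refine le_trans ?_ (Finset.single_le_sum (f := fun j => ‖S j i‖ ^ 2)
      (fun j _ => by positivity) (Finset.mem_univ i))
    exact sq_le_sq' (by linarith [abs_le.1 (Complex.abs_re_le_norm (S i i))])
      (Complex.re_le_norm _)
  have h3 : ∑ i, ∑ j, ‖S j i‖ ^ 2 = ∑ i, ∑ j, ‖A j i‖ ^ 2 := by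
    rw [← trace_conjTranspose_mul_self_re, hSh, hSS, trace_conjTranspose_mul_self_re]
  have h4 : ∑ i, ∑ j, ‖A j i‖ ^ 2 ≤ d * (d * c ^ 2) := by
    have : ∑ i : ι, ∑ j : ι, ‖A j i‖ ^ 2 ≤ ∑ _i : ι, ∑ _j : ι, c ^ 2 := by
      refine Finset.sum_le_sum fun i _ => Finset.sum_le_sum fun j _ => ?_
      have := h j i
      rw [norm_sub_rev] at this
      exact pow_le_pow_left₀ (norm_nonneg _) this 2
    simpa [d] using this
  have h5 : S.trace.re ^ 2 ≤ (d ^ (3 / 2 : ℝ) * c) ^ 2 := by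
    have e : (d ^ (3 / 2 : ℝ)) ^ 2 = d ^ 3 := by
      rw [← Real.rpow_natCast, ← Real.rpow_mul hd, ← Real.rpow_natCast]; norm_num
    rw [mul_pow, e]
    calc S.trace.re ^ 2 ≤ d * (d * (d * c ^ 2)) :=
          h1.trans (mul_le_mul_of_nonneg_left (h2.trans (h3.le.trans h4)) hd)
      _ = d ^ 3 * c ^ 2 := by ring
  have h6 := (abs_le_of_sq_le_sq' h5 (by positivity)).2
  linarith

theorem traceDist_le_of_entry_le_div {ι : Type*} [Fintype ι] [DecidableEq ι] [Nonempty ι]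
    (ρ σ : Matrix ι ι ℂ) {ε ε₁ : ℝ} (h : ∀ j k, ‖σ j k - ρ j k‖ ≤ ε₁)
    (hε : ε₁ ≤ 2 * ε / (Fintype.card ι : ℝ) ^ (3 / 2 : ℝ)) : traceDist ρ σ ≤ ε := by
  obtain ⟨i⟩ := ‹Nonempty ι›
  have h0 : 0 ≤ ε₁ := (norm_nonneg _).trans (h i i)
  have hd : (0 : ℝ) < Fintype.card ι := by exact_mod_cast Fintype.card_pos
  have hp : 0 < (Fintype.card ι : ℝ) ^ (3 / 2 : ℝ) := Real.rpow_pos_of_pos hd _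
  have := traceDist_le_of_entry_le ρ σ h0 h
  rw [le_div_iff₀ hp] at hε
  linarith

/-! ### Classical shadows of the pair states -/

/-- The vector `(|j⟩ + c |k⟩) / √2`; for `c = 1` and `c = i` these are the states whose expectation
values determine the entry `ρ_jk`. -/
def pairVec {n : ℕ} (c : ℂ) (j k : Label n) : Label n → ℂ :=
  ((Real.sqrt 2 : ℂ)⁻¹) • (Pi.single j 1 + c • Pi.single k 1)

theorem phiVec_eq_pairVec {n : ℕ} (j k : Label n) : phiVec j k = pairVec 1 j k := by
  simp [phiVec, pairVec]

theorem psiVec_eq_pairVec {n : ℕ} (j k : Label n) : psiVec j k = pairVec Complex.I j k := rfl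

theorem inv_sqrt_two_mul_self : ((Real.sqrt 2 : ℂ)⁻¹) * ((Real.sqrt 2 : ℂ)⁻¹) = 1 / 2 := by
  rw [← mul_inv, ← Complex.ofReal_mul, Real.mul_self_sqrt (by norm_num)]; norm_num

theorem trace_ketBra_mul {n : ℕ} (v : Label n → ℂ) (A : Op n) :
    (ketBra v * A).trace = ∑ a, ∑ b, star (v a) * A a b * v b := by
  simp only [ketBra, Matrix.trace, Matrix.diag, Matrix.mul_apply, Matrix.vecMulVec_apply,
    Pi.star_apply]
  rw [Finset.sum_comm]
  exact Finset.sum_congr rfl fun a _ => Finset.sum_congr rfl fun b _ => by ring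

/-- `tr(|v⟩⟨v| A)` for a pair state involves only four entries of `A`. -/
theorem trace_ketBra_pairVec_mul {n : ℕ} (c : ℂ) (j k : Label n) (A : Op n) :
    (ketBra (pairVec c j k) * A).trace
      = 1 / 2 * (A j j + c * A j k + star c * A k j + star c * c * A k k) := by
  have hs : star ((Real.sqrt 2 : ℂ)⁻¹) = (Real.sqrt 2 : ℂ)⁻¹ := by
    rw [Complex.star_def, map_inv₀, Complex.conj_ofReal]
  have hv : ∀ a, pairVec c j k a = (Real.sqrt 2 : ℂ)⁻¹ *
      ((if a = j then 1 else 0) + c * (if a = k then 1 else 0)) := by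
    intro a; simp [pairVec, Pi.single_apply]
  have hterm : ∀ a b, star (pairVec c j k a) * A a b * pairVec c j k b
      = 1 / 2 * (((if a = j then 1 else 0) + star c * (if a = k then 1 else 0)) * A a b *
        ((if b = j then 1 else 0) + c * (if b = k then 1 else 0))) := by
    intro a b
    rw [hv, hv, star_mul', hs, ← inv_sqrt_two_mul_self]
    have : star ((if a = j then (1 : ℂ) else 0) + c * (if a = k then 1 else 0))
        = (if a = j then 1 else 0) + star c * (if a = k then 1 else 0) := by
      split_ifs <;> simp
    rw [this]; ring
  rw [trace_ketBra_mul]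
  simp only [hterm, ← Finset.mul_sum]
  congr 1
  simp only [mul_add, add_mul, Finset.sum_add_distrib, mul_ite, ite_mul, mul_one, mul_zero,
    one_mul, zero_mul, Finset.sum_ite_eq', Finset.mem_univ, if_true]
  simp
  ring

/-! ### Concentration of means and of medians of means -/

section Concentration

variable {Ω : Type*} [MeasurableSpace Ω] [Finite Ω] [MeasurableSingletonClass Ω]

theorem memLp_of_finite (P : Measure Ω) [IsProbabilityMeasure P] (X : Ω → ℝ) (p : ENNReal) :
    MemLp X p P := by
  obtain ⟨M, hM⟩ := (Set.finite_range fun ω => ‖X ω‖).bddAbove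
  exact MemLp.of_bound (Measurable.of_discrete).aestronglyMeasurable M
    (ae_of_all _ fun ω => hM ⟨ω, rfl⟩)

/-- Chebyshev's inequality for the mean of `m` independent samples. -/
theorem measure_mean_deviation_le (P : Measure Ω) [IsProbabilityMeasure P] (X : Ω → ℝ) {B η : ℝ}
    (hB : ∫ ω, X ω ^ 2 ∂P ≤ B) (hη : 0 < η) {m : ℕ} (hm : 0 < m) :
    (Measure.pi fun _ : Fin m => P).real {x | η < |(∑ t, X (x t)) / m - ∫ ω, X ω ∂P|}
      ≤ B / (m * η ^ 2) := by
  set Q := Measure.pi fun _ : Fin m => P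
  have hm' : (0 : ℝ) < m := by exact_mod_cast hm
  have hL := memLp_of_finite P X 2
  have hLi : ∀ t : Fin m, MemLp (fun x : Fin m → Ω => X (x t)) 2 Q := fun t =>
    memLp_of_finite Q _ 2
  have hmean : ∫ x, (∑ t, X (x t)) ∂Q = m * ∫ ω, X ω ∂P := by
    rw [integral_finsetSum _ fun t _ => (hLi t).integrable (by norm_num)]
    have : ∀ t : Fin m, ∫ x, X (x t) ∂Q = ∫ ω, X ω ∂P := fun t =>
      integral_comp_eval (μ := fun _ : Fin m => P) hL.1
    simp [this]
  have hvar : Var[fun x : Fin m → Ω => ∑ t, X (x t); Q] = m * Var[X; P] := by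
    have := variance_sum_pi (μ := fun _ : Fin m => P) (X := fun _ => X) fun _ => hL
    simp only [Finset.sum_const, Finset.card_univ, Fintype.card_fin, nsmul_eq_mul] at this
    rw [← this]
    congr 1
    ext x
    simp
  have hvB : Var[X; P] ≤ B := (variance_le_expectation_sq hL.1).trans hB
  have hV0 : 0 ≤ Var[X; P] := variance_nonneg _ _
  have hS : MemLp (fun x : Fin m → Ω => ∑ t, X (x t)) 2 Q := memLp_of_finite Q _ 2
  have hch := meas_ge_le_variance_div_sq hS (c := m * η) (by positivity)
  rw [hmean, hvar] at hch
  have hsub : {x : Fin m → Ω | η < |(∑ t, X (x t)) / m - ∫ ω, X ω ∂P|}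
      ⊆ {x | m * η ≤ |(∑ t, X (x t)) - m * ∫ ω, X ω ∂P|} := by
    intro x hx
    simp only [Set.mem_ofPred_eq] at hx ⊢
    have : (∑ t, X (x t)) - m * ∫ ω, X ω ∂P
        = m * ((∑ t, X (x t)) / m - ∫ ω, X ω ∂P) := by field_simp
    rw [this, abs_mul, abs_of_pos hm']
    exact (mul_lt_mul_of_pos_left hx hm').le
  refine (measureReal_mono hsub).trans ?_
  refine (ENNReal.toReal_mono ENNReal.ofReal_ne_top hch).trans ?_
  rw [ENNReal.toReal_ofReal (by positivity)]
  rw [mul_pow, div_le_div_iff₀ (by positivity) (by positivity)]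
  have : (m : ℝ) * Var[X; P] * (m * η ^ 2) = Var[X; P] * (m ^ 2 * η ^ 2) := by ring
  rw [this]
  exact mul_le_mul_of_nonneg_right hvB (by positivity)

/-- If the median of `2 K + 1` numbers is off by more than `η`, then so are `K + 1` of them. -/
theorem exists_card_of_median_deviation {K : ℕ} (x : Fin (2 * K + 1) → ℝ) {μ η : ℝ}
    (h : η < |median x - μ|) :
    ∃ T : Finset (Fin (2 * K + 1)), T.card = K + 1 ∧ ∀ a ∈ T, η < |x a - μ| := by
  have hmono : Monotone (x ∘ Tuple.sort x) := Tuple.monotone_sort x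
  set k : Fin (2 * K + 1) := ⟨K, by omega⟩
  have hmed : median x = (x ∘ Tuple.sort x) k := rfl
  rw [hmed] at h
  rcases lt_abs.1 h with h | h
  · refine ⟨(Finset.Ici k).map (Tuple.sort x).toEmbedding, ?_, ?_⟩
    · simp [k]; omega
    · intro a ha
      obtain ⟨i, hi, rfl⟩ := Finset.mem_map.1 ha
      have := hmono (Finset.mem_Ici.1 hi)
      refine lt_abs.2 (Or.inl ?_)
      simp only [Function.comp, Equiv.coe_toEmbedding] at *
      linarith
  · refine ⟨(Finset.Iic k).map (Tuple.sort x).toEmbedding, ?_, ?_⟩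
    · simp [k]
    · intro a ha
      obtain ⟨i, hi, rfl⟩ := Finset.mem_map.1 ha
      have := hmono (Finset.mem_Iic.1 hi)
      refine lt_abs.2 (Or.inr ?_)
      simp only [Function.comp, Equiv.coe_toEmbedding] at *
      linarith

/-- Median of means: if a batch mean deviates with probability at most `1/16`, then the median of
`2 K + 1` batch means deviates with probability at most `4^(-K)`. -/
theorem measure_medianOfMeans_deviation_le (P : Measure Ω) [IsProbabilityMeasure P] (X : Ω → ℝ)
    {B η : ℝ} (hB : ∫ ω, X ω ^ 2 ∂P ≤ B) (hη : 0 < η) {m : ℕ} (hm : 0 < m) (K : ℕ)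
    (hmB : 16 * B ≤ m * η ^ 2) :
    (Measure.pi fun _ : Fin (2 * K + 1) => Measure.pi fun _ : Fin m => P).real
      {x | η < |median (fun a => (∑ t, X (x a t)) / (m : ℝ)) - ∫ ω, X ω ∂P|} ≤ (1 / 4) ^ K := by
  set Q := Measure.pi fun _ : Fin m => P
  set R := Measure.pi fun _ : Fin (2 * K + 1) => Q
  set bad : Set (Fin m → Ω) := {y | η < |(∑ t, X (y t)) / m - ∫ ω, X ω ∂P|}
  have hm' : (0 : ℝ) < m := by exact_mod_cast hm
  have hbad : Q.real bad ≤ 1 / 16 := by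
    refine (measure_mean_deviation_le P X hB hη hm).trans ?_
    rw [div_le_div_iff₀ (by positivity) (by norm_num)]
    linarith
  have hsub : {x : Fin (2 * K + 1) → Fin m → Ω |
      η < |median (fun a => (∑ t, X (x a t)) / (m : ℝ)) - ∫ ω, X ω ∂P|}
      ⊆ ⋃ T ∈ (Finset.univ : Finset (Fin (2 * K + 1))).powersetCard (K + 1),
        {x | ∀ a ∈ T, x a ∈ bad} := by
    intro x hx
    obtain ⟨T, hT, h⟩ := exists_card_of_median_deviation _ hx
    simp only [Set.mem_iUnion]
    exact ⟨T, by simp [hT], h⟩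
  refine (measureReal_mono hsub (measure_ne_top _ _)).trans ?_
  refine (measureReal_biUnion_finset_le _ _).trans ?_
  have hone : ∀ T ∈ (Finset.univ : Finset (Fin (2 * K + 1))).powersetCard (K + 1),
      R.real {x | ∀ a ∈ T, x a ∈ bad} ≤ (1 / 16) ^ (K + 1) := by
    intro T hT
    have hcard : T.card = K + 1 := (Finset.mem_powersetCard.1 hT).2
    have hset : {x : Fin (2 * K + 1) → Fin m → Ω | ∀ a ∈ T, x a ∈ bad}
        = Set.univ.pi fun a => if a ∈ T then bad else Set.univ := by
      ext x
      simp only [Set.mem_ofPred_eq, Set.mem_univ_pi]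
      refine forall_congr' fun a => ?_
      split_ifs with h <;> simp [h]
    rw [hset, measureReal_def, Measure.pi_pi, ENNReal.toReal_prod]
    have : ∀ a : Fin (2 * K + 1), (Q (if a ∈ T then bad else Set.univ)).toReal
        = if a ∈ T then Q.real bad else 1 := by
      intro a; split_ifs <;> simp [measureReal_def]
    simp only [this]
    rw [Finset.prod_ite_mem, Finset.univ_inter, Finset.prod_const, hcard]
    exact pow_le_pow_left₀ measureReal_nonneg hbad _
  refine (Finset.sum_le_sum hone).trans ?_
  rw [Finset.sum_const, Finset.card_powersetCard, Finset.card_univ, Fintype.card_fin, nsmul_eq_mul]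
  have hch : ((Nat.choose (2 * K + 1) (K + 1) : ℕ) : ℝ) ≤ 2 ^ (2 * K + 1) := by
    exact_mod_cast Nat.choose_le_two_pow _ _
  calc ((Nat.choose (2 * K + 1) (K + 1) : ℕ) : ℝ) * (1 / 16) ^ (K + 1)
      ≤ 2 ^ (2 * K + 1) * (1 / 16) ^ (K + 1) := by gcongr
    _ = (1 / 8) * ((2 ^ 2) * (1 / 16)) ^ K := by rw [mul_pow, ← pow_mul]; ring
    _ ≤ 1 * (1 / 4) ^ K := by
        norm_num
    _ = (1 / 4) ^ K := one_mul _

/-- Hoeffding's inequality, two-sided, for the mean of independent samples in `[0, 1]`. -/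
theorem measure_mean_deviation_le_exp (P : Measure Ω) [IsProbabilityMeasure P] (X : Ω → ℝ) {η : ℝ}
    (hX : ∀ ω, X ω ∈ Set.Icc (0 : ℝ) 1) (hη : 0 < η) {N : ℕ} (hN : 0 < N) :
    (Measure.pi fun _ : Fin N => P).real {x | η < |(∑ t, X (x t)) / N - ∫ ω, X ω ∂P|}
      ≤ 2 * Real.exp (-(2 * N * η ^ 2)) := by
  set Q := Measure.pi fun _ : Fin N => P
  have hN' : (0 : ℝ) < N := by exact_mod_cast hN
  have hL := memLp_of_finite P X 2
  have hmean : ∀ t : Fin N, ∫ x, X (x t) ∂Q = ∫ ω, X ω ∂P := fun t =>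
    integral_comp_eval (μ := fun _ : Fin N => P) hL.1
  have hone : ∀ Y : Ω → ℝ,
      (∀ t : Fin N, HasSubgaussianMGF (fun x : Fin N → Ω => Y (x t)) ((‖(1 : ℝ) - 0‖₊ / 2) ^ 2) Q) →
      Q.real {x | N * η ≤ ∑ t, Y (x t)} ≤ Real.exp (-(2 * N * η ^ 2)) := by
    intro Y hY
    have hind : iIndepFun (fun (t : Fin N) (x : Fin N → Ω) => Y (x t)) Q :=
      iIndepFun_pi (μ := fun _ : Fin N => P) (X := fun _ => Y)
        fun t => (memLp_of_finite P Y 2).1.aemeasurable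
    refine (HasSubgaussianMGF.measure_sum_ge_le_of_iIndepFun hind (s := Finset.univ)
      (fun t _ => hY t) (by positivity)).trans ?_
    refine Real.exp_le_exp.2 (le_of_eq ?_)
    simp
    field_simp
  have hp : ∀ t : Fin N, HasSubgaussianMGF
      (fun x : Fin N → Ω => (fun ω => X ω - ∫ ω, X ω ∂P) (x t)) ((‖(1 : ℝ) - 0‖₊ / 2) ^ 2) Q := by
    intro t
    have := hasSubgaussianMGF_of_mem_Icc (μ := Q) (X := fun x : Fin N → Ω => X (x t)) (a := 0)
      (b := 1) (Measurable.of_discrete).aemeasurable (ae_of_all _ fun x => hX (x t))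
    rwa [hmean t] at this
  have hn : ∀ t : Fin N, HasSubgaussianMGF
      (fun x : Fin N → Ω => (fun ω => -(X ω - ∫ ω, X ω ∂P)) (x t)) ((‖(1 : ℝ) - 0‖₊ / 2) ^ 2) Q :=
    fun t => (hp t).neg
  have h1 := hone (fun ω => X ω - ∫ ω, X ω ∂P) hp
  have h2 := hone (fun ω => -(X ω - ∫ ω, X ω ∂P)) hn
  have hsub : {x : Fin N → Ω | η < |(∑ t, X (x t)) / N - ∫ ω, X ω ∂P|}
      ⊆ {x | N * η ≤ ∑ t, (X (x t) - ∫ ω, X ω ∂P)} ∪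
        {x | N * η ≤ ∑ t, -(X (x t) - ∫ ω, X ω ∂P)} := by
    intro x hx
    have e : ∑ t, (X (x t) - ∫ ω, X ω ∂P) = N * ((∑ t, X (x t)) / N - ∫ ω, X ω ∂P) := by
      rw [Finset.sum_sub_distrib]; simp; field_simp
    simp only [Set.mem_union, Set.mem_ofPred_eq, Finset.sum_neg_distrib, e]
    rcases lt_abs.1 (Set.mem_ofPred_eq ▸ hx : η < _) with h | h
    · exact Or.inl (mul_le_mul_of_nonneg_left h.le hN'.le)
    · refine Or.inr ?_
      rw [← mul_neg]
      exact mul_le_mul_of_nonneg_left h.le hN'.le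
  refine (measureReal_mono hsub).trans ((measureReal_union_le _ _).trans ?_)
  linarith

end Concentration

/-! ### From moments of the snapshots to tomography -/

theorem dim_pos (n : ℕ) : 0 < dim n := by unfold dim; positivity

theorem card_label (n : ℕ) : (Fintype.card (Label n) : ℝ) = dim n := by
  simp [dim]

section Density

variable {n : ℕ} {ρ : Op n}

theorem IsDensity.diag_re_nonneg (h : IsDensity ρ) (b : Label n) : 0 ≤ (ρ b b).re :=
  (Complex.nonneg_iff.1 (h.1.diag_nonneg (i := b))).1

theorem IsDensity.sum_diag_re (h : IsDensity ρ) : ∑ b, (ρ b b).re = 1 := by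
  have := congrArg Complex.re h.2
  simpa [Matrix.trace, Complex.re_sum] using this

theorem IsDensity.star_apply (h : IsDensity ρ) (j k : Label n) : star (ρ k j) = ρ j k :=
  h.1.isHermitian.apply j k

theorem IsDensity.diag_eq_re (h : IsDensity ρ) (j : Label n) : ρ j j = ((ρ j j).re : ℂ) :=
  (Complex.conj_eq_iff_re.1 (h.star_apply j j)).symm

theorem IsDensity.conjStarAlgAut (h : IsDensity ρ) (U : unitary (Op n)) :
    IsDensity (Unitary.conjStarAlgAut ℂ (Op n) U ρ) := by
  rw [Unitary.conjStarAlgAut_apply]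
  refine ⟨h.1.mul_mul_conjTranspose_same _, ?_⟩
  rw [Matrix.trace_mul_comm, ← mul_assoc, Unitary.coe_star_mul_self, one_mul, h.2]

/-- The identity by which an entry is recovered from expectation values. -/
theorem IsDensity.entry_eq (h : IsDensity ρ) (j k : Label n) :
    ρ j k = ((ketBra (phiVec j k) * ρ).trace.re : ℂ)
      - Complex.I * ((ketBra (psiVec j k) * ρ).trace.re : ℂ)
      - (1 - Complex.I) / 2 * (((ρ j j).re : ℂ) + ((ρ k k).re : ℂ)) := by
  have hkj : ρ k j = star (ρ j k) := (h.star_apply k j).symm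
  rw [phiVec_eq_pairVec, psiVec_eq_pairVec, trace_ketBra_pairVec_mul, trace_ketBra_pairVec_mul,
    hkj, h.diag_eq_re j, h.diag_eq_re k]
  apply Complex.ext <;> simp <;> ring

end Density

section Laws

variable {n : ℕ} {ι : Type} [Fintype ι]

instance (n : ℕ) : MeasurableSingletonClass (Clifford n) := ⟨fun _ => trivial⟩

theorem isProbabilityMeasure_bornLaw {ρ : Op n} (h : IsDensity ρ) :
    IsProbabilityMeasure (bornLaw ρ) := by
  refine ⟨?_⟩
  simp only [bornLaw, Measure.coe_finsetSum, Finset.sum_apply, Measure.smul_apply, measure_univ,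
    smul_eq_mul, mul_one]
  rw [← ENNReal.ofReal_sum_of_nonneg fun b _ => h.diag_re_nonneg b, h.sum_diag_re,
    ENNReal.ofReal_one]

theorem integral_bornLaw {ρ : Op n} (h : IsDensity ρ) (f : Label n → ℝ) :
    ∫ b, f b ∂bornLaw ρ = ∑ b, (ρ b b).re * f b := by
  unfold bornLaw
  rw [integral_finsetSum_measure]
  · refine Finset.sum_congr rfl fun b _ => ?_
    rw [integral_smul_measure, integral_dirac, ENNReal.toReal_ofReal (h.diag_re_nonneg b),
      smul_eq_mul]
  · exact fun b _ => (integrable_dirac (by simp)).smul_measure ENNReal.ofReal_ne_top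

/-- What is needed of a scheme of randomized measurements: it is a random unitary evolution, and
for the pair states the snapshots give an unbiased estimator of the expectation value, with second
moment at most `B`. -/
structure Scheme.IsShadow (S : Scheme n ι) (B : ℝ) : Prop where
  weight_nonneg : ∀ i, 0 ≤ S.weight i
  sum_weight : ∑ i, S.weight i = 1
  evolve_density : ∀ i ρ, IsDensity ρ → IsDensity (S.evolve i ρ)
  mean_eq : ∀ ρ, IsDensity ρ → ∀ c : ℂ, ‖c‖ = 1 → ∀ j k : Label n, j ≠ k →
    ∑ i, ∑ b, S.weight i * (S.evolve i ρ b b).re *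
      (ketBra (pairVec c j k) * snapshot S (i, b)).trace.re
        = (ketBra (pairVec c j k) * ρ).trace.re
  second_le : ∀ ρ, IsDensity ρ → ∀ c : ℂ, ‖c‖ = 1 → ∀ j k : Label n, j ≠ k →
    ∑ i, ∑ b, S.weight i * (S.evolve i ρ b b).re *
      (ketBra (pairVec c j k) * snapshot S (i, b)).trace.re ^ 2 ≤ B

variable {S : Scheme n ι} {B : ℝ} {ρ : Op n}

theorem Scheme.IsShadow.prob_nonneg (hS : S.IsShadow B) (h : IsDensity ρ) (i : ι) (b : Label n) :
    0 ≤ S.weight i * (S.evolve i ρ b b).re :=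
  mul_nonneg (hS.weight_nonneg i) ((hS.evolve_density i ρ h).diag_re_nonneg b)

variable [MeasurableSpace ι]

theorem Scheme.IsShadow.isProbabilityMeasure_roundLaw (hS : S.IsShadow B) (h : IsDensity ρ) :
    IsProbabilityMeasure (roundLaw S ρ) := by
  refine ⟨?_⟩
  simp only [roundLaw, Measure.coe_finsetSum, Finset.sum_apply, Measure.smul_apply, measure_univ,
    smul_eq_mul, mul_one]
  have : ∀ i, ∑ b, ENNReal.ofReal (S.weight i * (S.evolve i ρ b b).re)
      = ENNReal.ofReal (S.weight i) := fun i => by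
    rw [← ENNReal.ofReal_sum_of_nonneg fun b _ => hS.prob_nonneg h i b, ← Finset.mul_sum,
      (hS.evolve_density i ρ h).sum_diag_re, mul_one]
  simp only [this]
  rw [← ENNReal.ofReal_sum_of_nonneg fun i _ => hS.weight_nonneg i, hS.sum_weight,
    ENNReal.ofReal_one]

variable [MeasurableSingletonClass ι]

theorem Scheme.IsShadow.integral_roundLaw (hS : S.IsShadow B) (h : IsDensity ρ)
    (f : ι × Label n → ℝ) :
    ∫ x, f x ∂roundLaw S ρ = ∑ i, ∑ b, S.weight i * (S.evolve i ρ b b).re * f (i, b) := by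
  have hint : ∀ i b, Integrable f
      (ENNReal.ofReal (S.weight i * (S.evolve i ρ b b).re) • Measure.dirac (i, b)) :=
    fun i b => (integrable_dirac (by simp)).smul_measure ENNReal.ofReal_ne_top
  unfold roundLaw
  rw [integral_finsetSum_measure fun i _ => integrable_finsetSum_measure.2 fun b _ => hint i b]
  refine Finset.sum_congr rfl fun i _ => ?_
  rw [integral_finsetSum_measure fun b _ => hint i b]
  refine Finset.sum_congr rfl fun b _ => ?_
  rw [integral_smul_measure, integral_dirac, ENNReal.toReal_ofReal (hS.prob_nonneg h i b),
    smul_eq_mul]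

/-- Tomography from a shadow scheme: the entries are off by at most `2 ε / d^(3/2) = 4 η` once the
`d` frequencies and the `2 d²` expectation values are off by at most `η`, and the failure
probability is bounded by a union bound over these. -/
theorem Scheme.IsShadow.succeeds (hS : S.IsShadow B) {ε δ η : ℝ} (hη : 0 < η)
    (hηε : η = ε / (2 * dim n ^ (3 / 2 : ℝ))) {N K m : ℕ} (hN : 0 < N) (hm : 0 < m)
    (hmB : 16 * B ≤ m * η ^ 2)
    (hδ : dim n * (2 * Real.exp (-(2 * N * η ^ 2))) + dim n ^ 2 * (2 * (1 / 4) ^ K) ≤ δ) :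
    Succeeds S ε δ N K m := by
  intro ρ hρ
  have := isProbabilityMeasure_bornLaw hρ
  have := hS.isProbabilityMeasure_roundLaw hρ
  have hprob : IsProbabilityMeasure (dataLaw S ρ N K m) := by unfold dataLaw; infer_instance
  set μ := dataLaw S ρ N K m
  have hμ' : μ = (Measure.pi fun _ : Fin N => bornLaw ρ).prod
    (Measure.pi fun _ : Fin (2 * K + 1) =>
      Measure.pi fun _ : Fin m => roundLaw S ρ) := rfl
  set D : Label n → Set (Data n ι N K m) := fun j => {x | η < |diagEstimate x j - (ρ j j).re|}
    with hD
  set M : ℂ → Label n × Label n → Set (Data n ι N K m) := fun c p =>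
    {x | p.1 ≠ p.2 ∧ η < |shadowEstimate S (ketBra (pairVec c p.1 p.2)) x
      - (ketBra (pairVec c p.1 p.2) * ρ).trace.re|} with hM
  have hDle : ∀ j, μ.real (D j) ≤ 2 * Real.exp (-(2 * N * η ^ 2)) := by
    intro j
    have h1 := measure_mean_deviation_le_exp (bornLaw ρ) (fun b => if b = j then (1 : ℝ) else 0)
      (fun b => by split_ifs <;> simp) hη hN
    rw [integral_bornLaw hρ] at h1
    simp only [mul_ite, mul_one, mul_zero, Finset.sum_ite_eq', Finset.mem_univ, if_true] at h1
    have hset : D j = {y : Fin N → Label n |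
        η < |(∑ t, if y t = j then (1 : ℝ) else 0) / N - (ρ j j).re|} ×ˢ Set.univ := by
      ext x
      simp [hD, diagEstimate]
    rw [hset, hμ', measureReal_def, Measure.prod_prod, measure_univ, mul_one]
    exact h1
  have hMle : ∀ c : ℂ, ‖c‖ = 1 → ∀ p, μ.real (M c p) ≤ (1 / 4) ^ K := by
    rintro c hc ⟨j, k⟩
    by_cases hjk : j = k
    · simp [hM, hjk]
    have h1 := measure_medianOfMeans_deviation_le (roundLaw S ρ)
      (fun x => (ketBra (pairVec c j k) * snapshot S x).trace.re) (B := B)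
      (by rw [hS.integral_roundLaw hρ]; exact hS.second_le ρ hρ c hc j k hjk) hη hm K hmB
    rw [hS.integral_roundLaw hρ, hS.mean_eq ρ hρ c hc j k hjk] at h1
    have hset : M c (j, k) = Set.univ ×ˢ {y : Fin (2 * K + 1) → Fin m → ι × Label n |
        η < |median (fun a => (∑ t, (ketBra (pairVec c j k) * snapshot S (y a t)).trace.re) /
          (m : ℝ)) - (ketBra (pairVec c j k) * ρ).trace.re|} := by
      ext x
      simp [hM, hjk, shadowEstimate]
    rw [hset, hμ', measureReal_def, Measure.prod_prod, measure_univ, one_mul]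
    exact h1
  set bad : Set (Data n ι N K m) :=
    (⋃ j, D j) ∪ ⋃ p : Label n × Label n, (M 1 p ∪ M Complex.I p) with hbad
  have hbadle : μ.real bad ≤ δ := by
    refine le_trans ?_ hδ
    refine (measureReal_union_le _ _).trans (add_le_add ?_ ?_)
    · refine (measureReal_iUnion_fintype_le _).trans ?_
      refine (Finset.sum_le_sum fun j _ => hDle j).trans ?_
      rw [Finset.sum_const, Finset.card_univ, nsmul_eq_mul, card_label]
    · refine (measureReal_iUnion_fintype_le _).trans ?_
      refine (Finset.sum_le_sum (g := fun _ => 2 * (1 / 4 : ℝ) ^ K) fun p _ => ?_).trans ?_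
      · refine (measureReal_union_le _ _).trans ?_
        linarith [hMle 1 (by simp) p, hMle Complex.I (by simp) p]
      · rw [Finset.sum_const, Finset.card_univ, nsmul_eq_mul, Fintype.card_prod, Nat.cast_mul,
          card_label, sq]
  have hgood : 1 - δ ≤ μ.real badᶜ := by
    rw [probReal_compl_eq_one_sub (Set.toFinite bad).measurableSet]
    linarith
  refine (ENNReal.ofReal_le_of_le_toReal hgood).trans (measure_mono ?_)
  intro x hx
  simp only [hbad, Set.mem_compl_iff, Set.mem_union, Set.mem_iUnion, not_or, not_exists] at hx
  obtain ⟨hx1, hx2⟩ := hx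
  have hd : ∀ j, |diagEstimate x j - (ρ j j).re| ≤ η := fun j => not_lt.1 (hx1 j)
  have hphi : ∀ j k, j ≠ k → |shadowEstimate S (ketBra (phiVec j k)) x
      - (ketBra (phiVec j k) * ρ).trace.re| ≤ η := fun j k hjk => by
    rw [phiVec_eq_pairVec]
    exact not_lt.1 fun h => (hx2 (j, k)).1 ⟨hjk, h⟩
  have hpsi : ∀ j k, j ≠ k → |shadowEstimate S (ketBra (psiVec j k)) x
      - (ketBra (psiVec j k) * ρ).trace.re| ≤ η := fun j k hjk => by
    rw [psiVec_eq_pairVec]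
    exact not_lt.1 fun h => (hx2 (j, k)).2 ⟨hjk, h⟩
  have hdp : 0 < dim n ^ (3 / 2 : ℝ) := Real.rpow_pos_of_pos (dim_pos n) _
  have h4η : 2 * ε / dim n ^ (3 / 2 : ℝ) = 4 * η := by rw [hηε]; field_simp; ring
  have hoff : ∀ j k, j ≠ k → ‖offDiagEstimate S x j k - ρ j k‖ ≤ 4 * η := by
    intro j k hjk
    have e : offDiagEstimate S x j k - ρ j k
        = ((shadowEstimate S (ketBra (phiVec j k)) x
            - (ketBra (phiVec j k) * ρ).trace.re : ℝ) : ℂ)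
          + (-Complex.I) * ((shadowEstimate S (ketBra (psiVec j k)) x
            - (ketBra (psiVec j k) * ρ).trace.re : ℝ) : ℂ)
          + (-((1 - Complex.I) / 2)) * ((diagEstimate x j - (ρ j j).re : ℝ) : ℂ)
          + (-((1 - Complex.I) / 2)) * ((diagEstimate x k - (ρ k k).re : ℝ) : ℂ) := by
      rw [hρ.entry_eq j k, offDiagEstimate]
      push_cast
      ring
    have hI : ‖-((1 - Complex.I) / 2)‖ ≤ 1 := by
      rw [norm_neg, norm_div]
      have := norm_sub_le (1 : ℂ) Complex.I
      simp only [norm_one, Complex.norm_I] at this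
      simp only [Complex.norm_ofNat]
      linarith
    have hI' : ∀ j, ‖-((1 - Complex.I) / 2) * ((diagEstimate x j - (ρ j j).re : ℝ) : ℂ)‖ ≤ η := by
      intro j
      rw [norm_mul, Complex.norm_real, Real.norm_eq_abs]
      calc _ ≤ 1 * η := mul_le_mul hI (hd j) (abs_nonneg _) zero_le_one
        _ = η := one_mul _
    rw [e]
    refine (norm_add_le _ _).trans ?_
    refine (add_le_add_left (norm_add_le _ _) _).trans ?_
    refine (add_le_add_left (add_le_add_left (norm_add_le _ _) _) _).trans ?_
    have h1 := hphi j k hjk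
    have h2 := hpsi j k hjk
    have h3 := hI' j
    have h4 := hI' k
    rw [norm_mul (-Complex.I), norm_neg, Complex.norm_I, one_mul, Complex.norm_real,
      Complex.norm_real, Real.norm_eq_abs, Real.norm_eq_abs]
    linarith
  have hent : ∀ j k, ‖estimate S x j k - ρ j k‖ ≤ 2 * ε / dim n ^ (3 / 2 : ℝ) := by
    intro j k
    rw [h4η]
    simp only [estimate, Matrix.of_apply]
    split_ifs with h1 h2
    · subst h1
      rw [hρ.diag_eq_re j, ← Complex.ofReal_sub, Complex.norm_real, Real.norm_eq_abs]
      linarith [hd j]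
    · exact hoff j k h1
    · rw [← hρ.star_apply j k, ← star_sub, norm_star]
      exact hoff k j (Ne.symm h1)
  refine ⟨hent, traceDist_le_of_entry_le_div ρ _ hent ?_⟩
  rw [card_label]

end Laws

/-! ### Pauli strings and the symplectic sign -/

/-- Strings labelling the `n`-qubit Pauli operators. With `I, X, Y, Z` numbered `0, 1, 2, 3`, the
product of Pauli operators is bitwise exclusive or on the labels, up to a phase. -/
abbrev PauliIdx (n : ℕ) : Type := Fin n → Fin 4

/-- Exclusive or, letter by letter: the label of the product of two Pauli operators. -/
def pxor {n : ℕ} (p q : PauliIdx n) : PauliIdx n := fun i => p i ^^^ q i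

/-- The sign in `σ_a σ_b = ± σ_b σ_a`. -/
def sg (a b : Fin 4) : ℤ := if a = 0 ∨ b = 0 ∨ a = b then 1 else -1

/-- The sign in `P_p P_q = ± P_q P_p`. -/
def sgn {n : ℕ} (p q : PauliIdx n) : ℤ := ∏ i, sg (p i) (q i)

theorem sum_prod_eq_prod_sum {n : ℕ} {κ R : Type*} [Fintype κ] [DecidableEq κ] [CommSemiring R]
    (f : Fin n → κ → R) : ∑ x : Fin n → κ, ∏ i, f i (x i) = ∏ i, ∑ a, f i a := by
  rw [Finset.prod_univ_sum, Fintype.piFinset_univ]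

section Combinatorics

variable {n : ℕ}

theorem sg_comm (a b : Fin 4) : sg a b = sg b a := by revert a b; decide
theorem sg_xor (a b c : Fin 4) : sg (a ^^^ b) c = sg a c * sg b c := by revert a b c; decide
theorem sg_mul_self (a b : Fin 4) : sg a b * sg a b = 1 := by revert a b; decide
theorem sg_self (a : Fin 4) : sg a a = 1 := by revert a; decide
theorem sum_sg (a : Fin 4) : ∑ b, sg a b = if a = 0 then 4 else 0 := by revert a; decide

theorem sgn_comm (p q : PauliIdx n) : sgn p q = sgn q p :=
  Finset.prod_congr rfl fun _ _ => sg_comm _ _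

theorem sgn_pxor (p q r : PauliIdx n) : sgn (pxor p q) r = sgn p r * sgn q r := by
  simp only [sgn, pxor, sg_xor, Finset.prod_mul_distrib]

theorem sgn_self (p : PauliIdx n) : sgn p p = 1 := by simp [sgn, sg_self]

theorem sgn_mul_self (p q : PauliIdx n) : sgn p q * sgn p q = 1 := by
  simp only [sgn, ← Finset.prod_mul_distrib, sg_mul_self, Finset.prod_const_one]

theorem sgn_eq_one_or (p q : PauliIdx n) : sgn p q = 1 ∨ sgn p q = -1 :=
  mul_self_eq_one_iff.1 (sgn_mul_self p q)

theorem zero_pxor (p : PauliIdx n) : pxor 0 p = p := by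
  funext i
  have : ∀ a : Fin 4, 0 ^^^ a = a := by decide
  exact this _

theorem pxor_cancel (p q : PauliIdx n) : pxor (pxor p q) q = p := by
  funext i
  have : ∀ a b : Fin 4, (a ^^^ b) ^^^ b = a := by decide
  exact this _ _

theorem pxor_cancel_middle (p q : PauliIdx n) : pxor (pxor p q) p = q := by
  funext i
  have : ∀ a b : Fin 4, (a ^^^ b) ^^^ a = b := by decide
  exact this _ _

theorem pxor_left_injective (q : PauliIdx n) : Function.Injective fun h => pxor h q :=
  fun a b hab => by rw [← pxor_cancel a q, ← pxor_cancel b q]; exact congrArg (pxor · q) hab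

theorem pxor_ne_zero {p q : PauliIdx n} (h : p ≠ q) : pxor p q ≠ 0 := fun h0 =>
  h (by rw [← pxor_cancel p q, h0, zero_pxor])

theorem sum_sgn {p : PauliIdx n} (hp : p ≠ 0) : ∑ h, sgn p h = 0 := by
  simp only [sgn]
  rw [sum_prod_eq_prod_sum fun i a => sg (p i) a]
  obtain ⟨i, hi⟩ := Function.ne_iff.1 hp
  refine Finset.prod_eq_zero (Finset.mem_univ i) ?_
  rw [sum_sg]
  exact if_neg hi

/-- A quarter of all strings commute with `p` and anticommute with `q`. -/
theorem card_commute_anticommute {p q : PauliIdx n} (hp : p ≠ 0) (hq : q ≠ 0) (hpq : p ≠ q) :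
    4 * ((Finset.univ.filter fun h => sgn p h = 1 ∧ sgn q h = -1).card : ℤ) = 4 ^ n := by
  -- four times the indicator of the condition is a combination of characters with zero sum
  have h1 : ∀ h : PauliIdx n, (1 + sgn p h) * (1 - sgn q h)
      = if sgn p h = 1 ∧ sgn q h = -1 then 4 else 0 := by
    intro h
    rcases sgn_eq_one_or p h with h1 | h1 <;> rcases sgn_eq_one_or q h with h2 | h2 <;>
      simp [h1, h2]
  have h2 : ∑ h, (1 + sgn p h) * (1 - sgn q h) = 4 ^ n := by
    have : ∀ h, (1 + sgn p h) * (1 - sgn q h) = 1 + sgn p h - sgn q h - sgn (pxor p q) h := by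
      intro h; rw [sgn_pxor]; ring
    simp only [this, Finset.sum_sub_distrib, Finset.sum_add_distrib, sum_sgn hp, sum_sgn hq,
      sum_sgn (pxor_ne_zero hpq)]
    simp
  rw [← h2, Finset.sum_congr rfl fun h _ => h1 h, ← Finset.sum_filter, Finset.sum_const,
    nsmul_eq_mul, mul_comm]

theorem exists_anticommute_both {p q : PauliIdx n} (hp : p ≠ 0) (hq : q ≠ 0) :
    ∃ h, sgn p h = -1 ∧ sgn q h = -1 := by
  by_contra hcon
  have h1 : ∀ h : PauliIdx n, (1 - sgn p h) * (1 - sgn q h) = 0 := by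
    intro h
    rcases sgn_eq_one_or p h with h1 | h1
    · simp [h1]
    · rcases sgn_eq_one_or q h with h2 | h2
      · simp [h2]
      · exact absurd ⟨h, h1, h2⟩ hcon
  have h2 : ∑ h, (1 - sgn p h) * (1 - sgn q h) = 4 ^ n + ∑ h, sgn (pxor p q) h := by
    have : ∀ h, (1 - sgn p h) * (1 - sgn q h) = 1 - sgn p h - sgn q h + sgn (pxor p q) h := by
      intro h; rw [sgn_pxor]; ring
    simp only [this, Finset.sum_sub_distrib, Finset.sum_add_distrib, sum_sgn hp, sum_sgn hq]
    simp
  have h3 : 0 ≤ ∑ h, sgn (pxor p q) h := by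
    by_cases hpq : pxor p q = 0
    · rw [hpq]
      refine Finset.sum_nonneg fun h _ => ?_
      simp [sgn, sg]
    · rw [sum_sgn hpq]
  rw [Finset.sum_congr rfl fun h _ => h1 h, Finset.sum_const_zero] at h2
  have : (0 : ℤ) < 4 ^ n := by positivity
  omega

end Combinatorics

/-! ### Pauli operators -/

section Pauli

variable {n : ℕ}

theorem pauli1_isHermitian (a : Fin 4) (i j : Fin 2) : star (pauli1 a j i) = pauli1 a i j := by
  fin_cases a <;> fin_cases i <;> fin_cases j <;> simp [pauli1]

theorem pauli1_mul (a b : Fin 4) :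
    ∃ c : ℂ, pauli1 a * pauli1 b = c • pauli1 (a ^^^ b) := by
  fin_cases a <;> fin_cases b
  · exact ⟨1, by simp [pauli1]⟩
  · exact ⟨1, by simp [pauli1]⟩
  · exact ⟨1, by simp [pauli1]⟩
  · exact ⟨1, by simp [pauli1]⟩
  · exact ⟨1, by simp [pauli1]⟩
  · exact ⟨1, by simp [pauli1, Matrix.one_fin_two]⟩
  · exact ⟨Complex.I, by
      change pauli1 1 * pauli1 2 = Complex.I • pauli1 3; simp [pauli1]⟩
  · exact ⟨-Complex.I, by
      change pauli1 1 * pauli1 3 = -Complex.I • pauli1 2; simp [pauli1]⟩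
  · exact ⟨1, by simp [pauli1]⟩
  · exact ⟨-Complex.I, by
      change pauli1 2 * pauli1 1 = -Complex.I • pauli1 3; simp [pauli1]⟩
  · exact ⟨1, by simp [pauli1, Matrix.one_fin_two]⟩
  · exact ⟨Complex.I, by
      change pauli1 2 * pauli1 3 = Complex.I • pauli1 1; simp [pauli1]⟩
  · exact ⟨1, by simp [pauli1]⟩
  · exact ⟨Complex.I, by
      change pauli1 3 * pauli1 1 = Complex.I • pauli1 2; simp [pauli1]⟩
  · exact ⟨-Complex.I, by
      change pauli1 3 * pauli1 2 = -Complex.I • pauli1 1; simp [pauli1]⟩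
  · exact ⟨1, by simp [pauli1, Matrix.one_fin_two]⟩

theorem pauli1_mul_comm (a b : Fin 4) (i j : Fin 2) :
    (pauli1 a * pauli1 b) i j = (sg a b : ℂ) * (pauli1 b * pauli1 a) i j := by
  fin_cases a <;> fin_cases b <;> fin_cases i <;> fin_cases j <;>
    simp [pauli1, sg, Matrix.mul_apply]

theorem pauli1_mul_self (a : Fin 4) : pauli1 a * pauli1 a = 1 := by
  fin_cases a <;> simp [pauli1, Matrix.one_fin_two]

theorem trace_pauli1_mul (a b : Fin 4) :
    ∑ i, (pauli1 a * pauli1 b) i i = if a = b then 2 else 0 := by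
  fin_cases a <;> fin_cases b <;> simp [pauli1] <;> norm_num

theorem sum_pauli1_mul_pauli1 (i j k l : Fin 2) :
    ∑ a, pauli1 a i j * pauli1 a k l = if i = l ∧ j = k then 2 else 0 := by
  fin_cases i <;> fin_cases j <;> fin_cases k <;> fin_cases l <;>
    simp [pauli1, Fin.sum_univ_four] <;> norm_num

theorem sum_norm_pauli1 (i j : Fin 2) : ∑ a, ‖pauli1 a i j‖ = 2 := by
  fin_cases i <;> fin_cases j <;> simp [pauli1, Fin.sum_univ_four] <;> norm_num

theorem norm_pauli1_le (a : Fin 4) (i j : Fin 2) : ‖pauli1 a i j‖ ≤ 1 := by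
  fin_cases a <;> fin_cases i <;> fin_cases j <;> simp [pauli1]

theorem pauli_apply (p : PauliIdx n) (j k : Label n) :
    pauli p j k = ∏ i, pauli1 (p i) (j i) (k i) := rfl

theorem pauli_zero : (pauli 0 : Op n) = 1 := by
  ext j k
  simp only [pauli_apply, Pi.zero_apply, Matrix.one_apply]
  have : ∀ i, pauli1 0 (j i) (k i) = if j i = k i then 1 else 0 := fun i => by
    simp [pauli1, Matrix.one_apply]
  simp only [this]
  rw [Finset.prod_ite_zero]
  simp [funext_iff]

theorem pauli_mul_apply (p q : PauliIdx n) (j k : Label n) :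
    (pauli p * pauli q) j k = ∏ i, (pauli1 (p i) * pauli1 (q i)) (j i) (k i) := by
  simp only [Matrix.mul_apply, pauli_apply, ← Finset.prod_mul_distrib]
  exact sum_prod_eq_prod_sum fun i l => pauli1 (p i) (j i) l * pauli1 (q i) l (k i)

theorem conjTranspose_pauli (p : PauliIdx n) : (pauli p).conjTranspose = pauli p := by
  ext j k
  simp only [Matrix.conjTranspose_apply, pauli_apply, star_prod, pauli1_isHermitian]

theorem pauli_mul_comm (p q : PauliIdx n) :
    pauli p * pauli q = (sgn p q : ℂ) • (pauli q * pauli p) := by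
  ext j k
  rw [Matrix.smul_apply, pauli_mul_apply, pauli_mul_apply, sgn, smul_eq_mul, Int.cast_prod,
    ← Finset.prod_mul_distrib]
  exact Finset.prod_congr rfl fun i _ => pauli1_mul_comm _ _ _ _

theorem pauli_mul_self (p : PauliIdx n) : pauli p * pauli p = 1 := by
  rw [← pauli_zero]
  ext j k
  rw [pauli_mul_apply, pauli_apply]
  simp only [pauli1_mul_self, Pi.zero_apply]
  rfl

theorem exists_pauli_mul (p q : PauliIdx n) :
    ∃ c : ℂ, pauli p * pauli q = c • pauli (pxor p q) := by
  choose c h using fun i => pauli1_mul (p i) (q i)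
  refine ⟨∏ i, c i, ?_⟩
  ext j k
  rw [pauli_mul_apply, Matrix.smul_apply, pauli_apply, smul_eq_mul, ← Finset.prod_mul_distrib]
  refine Finset.prod_congr rfl fun i _ => ?_
  rw [h i, Matrix.smul_apply, smul_eq_mul, pxor]

theorem trace_pauli_mul (p q : PauliIdx n) :
    (pauli p * pauli q).trace = if p = q then (2 : ℂ) ^ n else 0 := by
  simp only [Matrix.trace, Matrix.diag, pauli_mul_apply]
  rw [sum_prod_eq_prod_sum fun i l => (pauli1 (p i) * pauli1 (q i)) l l]
  simp only [trace_pauli1_mul]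
  rw [Finset.prod_ite_zero]
  simp [funext_iff]

/-- Distinct Pauli operators are distinct up to sign. -/
theorem eq_of_pauli_eq {p q : PauliIdx n} (h : pauli p = pauli q ∨ pauli p = -pauli q) :
    p = q := by
  by_contra hpq
  have h1 := trace_pauli_mul p q
  rw [if_neg hpq] at h1
  have h2 := trace_pauli_mul q q
  rw [if_pos rfl] at h2
  rcases h with h | h <;> rw [h] at h1 <;> simp [h2] at h1

/-- `∑_a σ_{c a}(i, j) σ_{c a}(k, l)` controls the tensor `∑_z P_z ⊗ P_z` over all strings `z` in
the letters `c a`. -/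
theorem sum_trace_mul_trace {τ : Type*} [Fintype τ] [DecidableEq τ] (c : τ → Fin 4) (A B : Op n) :
    ∑ z : Fin n → τ, (A * pauli fun i => c (z i)).trace * (B * pauli fun i => c (z i)).trace
      = ∑ j, ∑ k, ∑ j', ∑ k', A j k * B j' k' *
          ∏ i, ∑ a, pauli1 (c a) (k i) (j i) * pauli1 (c a) (k' i) (j' i) := by
  have htr : ∀ (A : Op n) (p : PauliIdx n), (A * pauli p).trace
      = ∑ j, ∑ k, A j k * pauli p k j := fun A p => by
    simp [Matrix.trace, Matrix.mul_apply]
  have hterm : ∀ z : Fin n → τ,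
      (A * pauli fun i => c (z i)).trace * (B * pauli fun i => c (z i)).trace
      = ∑ j, ∑ k, ∑ j', ∑ k', A j k * B j' k' *
          ∏ i, pauli1 (c (z i)) (k i) (j i) * pauli1 (c (z i)) (k' i) (j' i) := fun z => by
    rw [htr, htr]
    simp only [Finset.sum_mul]
    refine Finset.sum_congr rfl fun j _ => Finset.sum_congr rfl fun k _ => ?_
    simp only [Finset.mul_sum]
    refine Finset.sum_congr rfl fun j' _ => Finset.sum_congr rfl fun k' _ => ?_
    rw [pauli_apply, pauli_apply, Finset.prod_mul_distrib]
    ring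
  simp only [hterm]
  rw [Finset.sum_comm]
  refine Finset.sum_congr rfl fun j _ => ?_
  rw [Finset.sum_comm]
  refine Finset.sum_congr rfl fun k _ => ?_
  rw [Finset.sum_comm]
  refine Finset.sum_congr rfl fun j' _ => ?_
  rw [Finset.sum_comm]
  refine Finset.sum_congr rfl fun k' _ => ?_
  rw [← Finset.mul_sum]
  congr 1
  exact sum_prod_eq_prod_sum
    fun i a => pauli1 (c a) (k i) (j i) * pauli1 (c a) (k' i) (j' i)

/-- Completeness of the Pauli operators. -/
theorem sum_trace_pauli_mul_trace_pauli (A B : Op n) :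
    ∑ p : PauliIdx n, (A * pauli p).trace * (B * pauli p).trace
      = (2 : ℂ) ^ n * (A * B).trace := by
  refine (sum_trace_mul_trace (fun a : Fin 4 => a) A B).trans ?_
  have : ∀ j k j' k' : Label n,
      ∏ i, ∑ a, pauli1 a (k i) (j i) * pauli1 a (k' i) (j' i)
        = if j' = k then (if k' = j then (2 : ℂ) ^ n else 0) else 0 := by
    intro j k j' k'
    simp only [sum_pauli1_mul_pauli1]
    rw [Finset.prod_ite_zero]
    simp only [Finset.mem_univ, true_implies, forall_and, Finset.prod_const, Finset.card_univ,
      Fintype.card_fin, ← ite_and, funext_iff, eq_comm]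
  simp only [this, mul_ite, mul_zero]
  have h2 : ∀ j k : Label n, (∑ j', ∑ k', if j' = k then
      (if k' = j then A j k * B j' k' * (2 : ℂ) ^ n else 0) else 0) = 2 ^ n * (A j k * B k j) := by
    intro j k
    rw [Finset.sum_eq_single k (fun b _ hb => by simp [hb]) (by simp)]
    simp [mul_comm]
  simp only [h2, ← Finset.mul_sum]
  rw [Matrix.trace]
  simp [Matrix.mul_apply]

/-- The string of the product of the operators `Z_i` with `z i = 1`. -/
def zIdx (z : Label n) : PauliIdx n := fun i => if z i = 0 then 0 else 3

theorem zIdx_injective : Function.Injective (zIdx (n := n)) := by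
  intro z w h
  funext i
  have h1 := congrFun h i
  have : ∀ a b : Fin 2, (if a = 0 then (0 : Fin 4) else 3) = (if b = 0 then 0 else 3) → a = b := by
    decide
  exact this _ _ h1

theorem zIdx_zero : zIdx (0 : Label n) = 0 := by funext i; simp [zIdx]

theorem zIdx_eq_zero {z : Label n} : zIdx z = 0 ↔ z = 0 :=
  ⟨fun h => zIdx_injective (h.trans zIdx_zero.symm), fun h => h ▸ zIdx_zero⟩

/-- The diagonal Pauli operators are a basis of the diagonal matrices. -/
theorem sum_diag_mul_diag (A B : Op n) :
    (2 : ℂ) ^ n * ∑ b, A b b * B b b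
      = ∑ z : Label n, (A * pauli (zIdx z)).trace * (B * pauli (zIdx z)).trace := by
  refine Eq.symm ((sum_trace_mul_trace (fun a : Fin 2 => if a = 0 then 0 else 3) A B).trans ?_)
  have h1 : ∀ i j k l : Fin 2, ∑ a : Fin 2, pauli1 (if a = 0 then 0 else 3) i j *
      pauli1 (if a = 0 then 0 else 3) k l = if i = j ∧ k = j ∧ l = j then (2 : ℂ) else 0 := by
    intro i j k l
    fin_cases i <;> fin_cases j <;> fin_cases k <;> fin_cases l <;>
      simp [pauli1] <;> norm_num
  have h2 : ∀ j k j' k' : Label n,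
      ∏ i, ∑ a : Fin 2, pauli1 (if a = 0 then 0 else 3) (k i) (j i) *
        pauli1 (if a = 0 then 0 else 3) (k' i) (j' i)
        = if k = j then (if k' = j then (if j' = j then (2 : ℂ) ^ n else 0) else 0) else 0 := by
    intro j k j' k'
    simp only [h1]
    rw [Finset.prod_ite_zero]
    simp only [Finset.mem_univ, true_implies, forall_and, Finset.prod_const, Finset.card_univ,
      Fintype.card_fin, ← ite_and, funext_iff]
  simp only [h2, mul_ite, mul_zero]
  rw [Finset.mul_sum]
  refine Finset.sum_congr rfl fun j _ => ?_
  rw [Finset.sum_eq_single j (fun b _ hb => by simp [hb]) (by simp),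
    Finset.sum_eq_single j (fun b _ hb => by simp [hb]) (by simp),
    Finset.sum_eq_single j (fun b _ hb => by simp [hb]) (by simp)]
  simp [mul_comm]

theorem norm_pauli_apply_le (p : PauliIdx n) (j k : Label n) : ‖pauli p j k‖ ≤ 1 := by
  rw [pauli_apply, norm_prod]
  exact Finset.prod_le_one (fun _ _ => norm_nonneg _) fun i _ => norm_pauli1_le _ _ _

theorem sum_norm_pauli_apply (j k : Label n) : ∑ p : PauliIdx n, ‖pauli p j k‖ = 2 ^ n := by
  simp only [pauli_apply, norm_prod]
  rw [sum_prod_eq_prod_sum fun i a => ‖pauli1 a (j i) (k i)‖]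
  simp [sum_norm_pauli1]

/-- A diagonal entry is bounded by the Pauli expectation values. -/
theorem norm_diag_le (A : Op n) (b : Label n) :
    2 ^ n * ‖A b b‖ ≤ ∑ z : Label n, ‖(A * pauli (zIdx z)).trace‖ := by
  have h := sum_diag_mul_diag A (basisProj b)
  have h1 : ∑ c, A c c * (basisProj b : Op n) c c = A b b := by
    rw [Finset.sum_eq_single b (fun c _ hc => by simp [basisProj, Matrix.single, hc.symm])
      (by simp)]
    simp [basisProj]
  have h2 : ∀ z : Label n, (basisProj b * pauli (zIdx z)).trace = pauli (zIdx z) b b := by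
    intro z
    rw [basisProj, Matrix.trace_single_mul, one_smul]
  rw [h1] at h
  have h3 : 2 ^ n * ‖A b b‖ = ‖(2 : ℂ) ^ n * A b b‖ := by simp
  rw [h3, h]
  refine (norm_sum_le _ _).trans (Finset.sum_le_sum fun z _ => ?_)
  rw [norm_mul, h2]
  exact mul_le_of_le_one_right (norm_nonneg _) (norm_pauli_apply_le _ _ _)

end Pauli

/-! ### Transvections in the Clifford group -/

section Transvection

variable {n : ℕ}

/-- The symplectic transvection along `h`, on labels of Pauli operators. -/
def transvect (h p : PauliIdx n) : PauliIdx n := if sgn h p = 1 then p else pxor h p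

/-- Conjugation by `(1 + c P_h) / √2`, where `c² = -1`, acts on Pauli operators as the transvection
along `h`, up to signs. -/
theorem conj_pauli_eq_transvect {c : ℂ} (hc : c * c = -1) (h p : PauliIdx n) :
    (((Real.sqrt 2 : ℂ)⁻¹) • (1 + c • pauli h)) * pauli p *
        (((Real.sqrt 2 : ℂ)⁻¹) • (1 - c • pauli h)) = pauli (transvect h p) ∨
      (((Real.sqrt 2 : ℂ)⁻¹) • (1 + c • pauli h)) * pauli p *
        (((Real.sqrt 2 : ℂ)⁻¹) • (1 - c • pauli h)) = -pauli (transvect h p) := by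
  have hcomm := pauli_mul_comm h p
  have hpp := pauli_mul_self h
  have hhalf : ∀ X Y Z : Op n, (((Real.sqrt 2 : ℂ)⁻¹) • X) * Y * (((Real.sqrt 2 : ℂ)⁻¹) • Z)
      = (1 / 2 : ℂ) • (X * Y * Z) := fun X Y Z => by
    rw [smul_mul_assoc, smul_mul_assoc, mul_smul_comm, smul_smul, inv_sqrt_two_mul_self]
  rw [hhalf]
  rcases sgn_eq_one_or h p with hs | hs
  · left
    rw [hs, Int.cast_one, one_smul] at hcomm
    have h1 : (1 + c • pauli h) * pauli p * (1 - c • pauli h)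
        = pauli p - (c * c) • (pauli p * (pauli h * pauli h)) := by
      simp only [add_mul, mul_sub, one_mul, mul_one, smul_mul_assoc, mul_smul_comm, hcomm,
        mul_assoc, smul_smul, smul_add]
      abel
    rw [h1, hc, hpp, mul_one, transvect, if_pos hs, neg_smul, one_smul, sub_neg_eq_add,
      ← two_smul ℂ, smul_smul]
    norm_num
  · rw [hs, Int.cast_neg, Int.cast_one, neg_one_smul] at hcomm
    have hcomm' : pauli p * pauli h = -(pauli h * pauli p) := by rw [hcomm, neg_neg]
    have h1 : (1 + c • pauli h) * pauli p * (1 - c • pauli h)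
        = pauli p + (c * c) • (pauli h * pauli h * pauli p) + (2 * c) • (pauli h * pauli p) := by
      rw [two_mul, add_smul]
      simp only [add_mul, mul_sub, one_mul, mul_one, smul_mul_assoc, mul_smul_comm, hcomm',
        mul_assoc, smul_smul, smul_add, mul_neg, smul_neg]
      abel
    obtain ⟨c', hc'⟩ := exists_pauli_mul h p
    -- anticommutation forces the phase `c'` to be `±i`, so that `c * c'` is a sign
    have hsq : c' * c' = -1 := by
      have h2 : (pauli h * pauli p) * (pauli h * pauli p) = -1 := by
        calc (pauli h * pauli p) * (pauli h * pauli p)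
            = pauli h * (pauli p * pauli h) * pauli p := by simp only [mul_assoc]
          _ = -((pauli h * pauli h) * (pauli p * pauli p)) := by
              rw [hcomm']; simp only [mul_neg, neg_mul, mul_assoc]
          _ = -1 := by rw [hpp, pauli_mul_self, one_mul]
      rw [hc', smul_mul_smul_comm, pauli_mul_self] at h2
      have h3 := congrFun (congrFun h2 0) 0
      simpa using h3
    have h4 : (c * c') * (c * c') = 1 := by
      calc (c * c') * (c * c') = (c * c) * (c' * c') := by ring
        _ = 1 := by rw [hc, hsq]; norm_num
    have h5 : (1 / 2 : ℂ) • ((1 + c • pauli h) * pauli p * (1 - c • pauli h))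
        = (c * c') • pauli (transvect h p) := by
      rw [h1, hc, hpp, one_mul, neg_one_smul, add_neg_cancel, zero_add, hc', smul_smul, smul_smul,
        transvect, if_neg (by rw [hs]; norm_num)]
      congr 1
      ring
    rw [h5]
    rcases mul_self_eq_one_iff.1 h4 with h6 | h6 <;> rw [h6]
    · left; rw [one_smul]
    · right; rw [neg_one_smul]

/-- The unitary `(1 - i P_h) / √2` inducing the transvection along `h`. -/
def transvection (h : PauliIdx n) : unitary (Op n) :=
  ⟨((Real.sqrt 2 : ℂ)⁻¹) • (1 + (-Complex.I) • pauli h), by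
    have hs : star (((Real.sqrt 2 : ℂ)⁻¹) • ((1 : Op n) + (-Complex.I) • pauli h))
        = ((Real.sqrt 2 : ℂ)⁻¹) • (1 - (-Complex.I) • pauli h) := by
      rw [star_smul, star_add, star_one, star_smul, Matrix.star_eq_conjTranspose (pauli h),
        conjTranspose_pauli]
      simp [Complex.conj_ofReal, sub_eq_add_neg]
    have hpp := pauli_mul_self h
    have hI : (-Complex.I) * (-Complex.I) = -1 := by simp
    have h1 : ((1 : Op n) + (-Complex.I) • pauli h) * (1 - (-Complex.I) • pauli h)
        = (2 : ℂ) • 1 := by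
      have : ((1 : Op n) + (-Complex.I) • pauli h) * (1 - (-Complex.I) • pauli h)
          = 1 - ((-Complex.I) • pauli h) * ((-Complex.I) • pauli h) := by
        generalize (-Complex.I) • pauli h = X
        noncomm_ring
      rw [this, smul_mul_smul_comm, hpp, hI, neg_one_smul, sub_neg_eq_add, two_smul]
    have h2 : ((1 : Op n) - (-Complex.I) • pauli h) * (1 + (-Complex.I) • pauli h)
        = (2 : ℂ) • 1 := by
      have : ((1 : Op n) - (-Complex.I) • pauli h) * (1 + (-Complex.I) • pauli h)
          = 1 - ((-Complex.I) • pauli h) * ((-Complex.I) • pauli h) := by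
        generalize (-Complex.I) • pauli h = X
        noncomm_ring
      rw [this, smul_mul_smul_comm, hpp, hI, neg_one_smul, sub_neg_eq_add, two_smul]
    rw [Unitary.mem_iff, hs]
    constructor
    · rw [smul_mul_smul_comm, inv_sqrt_two_mul_self, h2, smul_smul]; norm_num
    · rw [smul_mul_smul_comm, inv_sqrt_two_mul_self, h1, smul_smul]; norm_num⟩

theorem coe_transvection (h : PauliIdx n) :
    (transvection h : Op n) = ((Real.sqrt 2 : ℂ)⁻¹) • (1 + (-Complex.I) • pauli h) := rfl

theorem star_coe_transvection (h : PauliIdx n) :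
    star (transvection h : Op n) = ((Real.sqrt 2 : ℂ)⁻¹) • (1 - (-Complex.I) • pauli h) := by
  rw [coe_transvection, star_smul, star_add, star_one, star_smul,
    Matrix.star_eq_conjTranspose (pauli h), conjTranspose_pauli]
  simp [Complex.conj_ofReal, sub_eq_add_neg]

theorem isClifford_transvection (h : PauliIdx n) : IsClifford (transvection h) := fun p =>
  ⟨transvect h p, by
    rw [star_coe_transvection, coe_transvection]
    exact conj_pauli_eq_transvect (by simp) h p⟩

theorem IsClifford.mul {U V : unitary (Op n)} (hU : IsClifford U) (hV : IsClifford V) :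
    IsClifford (U * V) := by
  have e : ∀ X : Op n,
      ((U * V : unitary (Op n)) : Op n) * X * star ((U * V : unitary (Op n)) : Op n)
        = U * (V * X * star (V : Op n)) * star (U : Op n) := fun X => by
    rw [Submonoid.coe_mul, star_mul]; simp only [mul_assoc]
  intro p
  obtain ⟨q, hq⟩ := hV p
  obtain ⟨r, hr⟩ := hU q
  refine ⟨r, ?_⟩
  rw [e]
  rcases hq with hq | hq <;> rcases hr with hr | hr <;> rw [hq] <;>
    simp [mul_neg, neg_mul, hr]

/-- Composing with a transvection permutes the Clifford group. -/
theorem exists_perm_transvect (h : PauliIdx n) :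
    ∃ e : Equiv.Perm (Clifford n), ∀ α p,
      (e α).1.symm (pauli p) = α.1.symm (pauli (transvect h p)) ∨
      (e α).1.symm (pauli p) = -α.1.symm (pauli (transvect h p)) := by
  set W := Unitary.conjStarAlgAut ℂ (Op n) (transvection h) with hW
  have hmem : ∀ α : Clifford n, ∃ U : unitary (Op n), IsClifford U ∧
      W * α.1 = Unitary.conjStarAlgAut ℂ (Op n) U := by
    rintro ⟨α, U, hU, rfl⟩
    exact ⟨transvection h * U, (isClifford_transvection h).mul hU, by rw [map_mul]⟩
  let f : Clifford n → Clifford n := fun α => ⟨W * α.1, hmem α⟩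
  have hf : Function.Injective f := fun α β hab =>
    Subtype.ext (mul_left_cancel (congrArg Subtype.val hab))
  refine ⟨Equiv.ofBijective f (Finite.injective_iff_bijective.1 hf), fun α p => ?_⟩
  have hsymm : (W * α.1).symm (pauli p) = α.1.symm (W.symm (pauli p)) := rfl
  have hWs : W.symm (pauli p) = pauli (transvect h p) ∨
      W.symm (pauli p) = -pauli (transvect h p) := by
    rw [hW, Unitary.conjStarAlgAut_symm_apply, star_coe_transvection, coe_transvection]
    have := conj_pauli_eq_transvect (c := Complex.I) (by simp) h p
    simpa [sub_eq_add_neg] using this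
  change (W * α.1).symm (pauli p) = _ ∨ (W * α.1).symm (pauli p) = _
  rw [hsymm]
  rcases hWs with h1 | h1 <;> rw [h1]
  · exact Or.inl rfl
  · exact Or.inr (map_neg _ _)

/-- A Clifford element permutes the Pauli operators up to signs. -/
theorem Clifford.exists_perm (α : Clifford n) :
    ∃ f : Equiv.Perm (PauliIdx n), ∀ p,
      α.1.symm (pauli p) = pauli (f p) ∨ α.1.symm (pauli p) = -pauli (f p) := by
  have h : ∀ p, ∃ q, α.1 (pauli p) = pauli q ∨ α.1 (pauli p) = -pauli q := by
    obtain ⟨α, U, hU, rfl⟩ := α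
    intro p
    simpa using hU p
  choose g hg using h
  have hinj : Function.Injective g := by
    intro p q hpq
    have h1 := hg p
    have h2 := hg q
    rw [hpq] at h1
    refine eq_of_pauli_eq ?_
    have h3 : α.1 (pauli p) = α.1 (pauli q) ∨ α.1 (pauli p) = α.1 (-pauli q) := by
      rw [map_neg]
      rcases h1 with h1 | h1 <;> rcases h2 with h2 | h2 <;> simp [h1, h2]
    exact h3.imp (fun h => α.1.injective h) fun h => α.1.injective h
  set e := Equiv.ofBijective g (Finite.injective_iff_bijective.1 hinj)
  refine ⟨e.symm, fun p => ?_⟩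
  have h1 := hg (e.symm p)
  have h2 : g (e.symm p) = p := e.apply_symm_apply p
  rw [h2] at h1
  rcases h1 with h1 | h1
  · left
    rw [← h1]
    exact α.1.symm_apply_apply _
  · right
    have : pauli p = α.1 (-pauli (e.symm p)) := by rw [map_neg, h1, neg_neg]
    rw [this]
    exact α.1.symm_apply_apply _

end Transvection

/-! ### Moments of the Clifford group -/

section CliffordMoments

variable {n : ℕ} {R : Type*} [CommRing R]

/-- The sum of `F(α⁻¹ P_p, α⁻¹ P_q)` over the Clifford group. -/
def cliffordSum (F : Op n → Op n → R) (p q : PauliIdx n) : R :=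
  ∑ α : Clifford n, F (α.1.symm (pauli p)) (α.1.symm (pauli q))

theorem cliffordSum_transvect {F : Op n → Op n → R} (h1 : ∀ X Y, F (-X) Y = F X Y)
    (h2 : ∀ X Y, F X (-Y) = F X Y) (h p q : PauliIdx n) :
    cliffordSum F (transvect h p) (transvect h q) = cliffordSum F p q := by
  obtain ⟨e, he⟩ := exists_perm_transvect h
  unfold cliffordSum
  rw [← Equiv.sum_comp e fun α => F (α.1.symm (pauli p)) (α.1.symm (pauli q))]
  refine Finset.sum_congr rfl fun α _ => ?_
  rcases he α p with hp | hp <;> rcases he α q with hq | hq <;> simp only [hp, hq, h1, h2]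

theorem sum_symm_pauli {f : Op n → R} (hf : ∀ X, f (-X) = f X) (α : Clifford n) :
    ∑ p, f (α.1.symm (pauli p)) = ∑ p : PauliIdx n, f (pauli p) := by
  obtain ⟨e, he⟩ := α.exists_perm
  rw [← Equiv.sum_comp e fun p => f (pauli p)]
  refine Finset.sum_congr rfl fun p _ => ?_
  rcases he p with h | h <;> simp only [h, hf]

/-- The Clifford group acts transitively on the nontrivial Pauli operators up to signs. -/
theorem cliffordSum_eq_of_ne_zero {f : Op n → R} (hf : ∀ X, f (-X) = f X) {p q : PauliIdx n}
    (hp : p ≠ 0) (hq : q ≠ 0) :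
    cliffordSum (fun X _ => f X) p p = cliffordSum (fun X _ => f X) q q := by
  have hstep : ∀ {p y : PauliIdx n}, sgn p y = -1 →
      cliffordSum (fun X _ => f X) y y = cliffordSum (fun X _ => f X) p p := by
    intro p y hpy
    -- the transvection along the product of anticommuting operators exchanges them
    have ht : transvect (pxor p y) p = y := by
      rw [transvect, sgn_pxor, sgn_self, one_mul, sgn_comm, hpy, if_neg (by norm_num),
        pxor_cancel_middle]
    have := cliffordSum_transvect (F := fun X _ => f X) (fun X _ => hf X) (fun _ _ => rfl)
      (pxor p y) p p
    rwa [ht] at this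
  obtain ⟨y, h1, h2⟩ := exists_anticommute_both hp hq
  rw [← hstep h1, hstep h2]

/-- The Clifford average over the orbit of a nontrivial Pauli operator. -/
theorem cliffordSum_single {f : Op n → R} (hf : ∀ X, f (-X) = f X) {p : PauliIdx n}
    (hp : p ≠ 0) :
    ((2 : R) ^ n * 2 ^ n - 1) * cliffordSum (fun X _ => f X) p p
      = Fintype.card (Clifford n) * (∑ q : PauliIdx n, f (pauli q) - f 1) := by
  have h1 : ∑ q : PauliIdx n, cliffordSum (fun X _ => f X) q q
      = Fintype.card (Clifford n) * ∑ q : PauliIdx n, f (pauli q) := by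
    unfold cliffordSum
    rw [Finset.sum_comm]
    simp only [sum_symm_pauli hf]
    simp
  have h0 : cliffordSum (fun X _ => f X) (0 : PauliIdx n) 0 = Fintype.card (Clifford n) * f 1 := by
    simp [cliffordSum, pauli_zero]
  have h2 : ∑ q : PauliIdx n, cliffordSum (fun X _ => f X) q q
      = cliffordSum (fun X _ => f X) 0 0
        + ((2 : R) ^ n * 2 ^ n - 1) * cliffordSum (fun X _ => f X) p p := by
    rw [← Finset.add_sum_erase _ _ (Finset.mem_univ (0 : PauliIdx n))]
    congr 1
    rw [Finset.sum_congr rfl fun q hq =>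
      cliffordSum_eq_of_ne_zero hf (Finset.ne_of_mem_erase hq) hp, Finset.sum_const,
      Finset.card_erase_of_mem (Finset.mem_univ _), nsmul_eq_mul,
      Nat.cast_sub (by simp [Nat.one_le_iff_ne_zero])]
    congr 1
    simp only [Finset.card_univ, Fintype.card_pi, Fintype.card_fin, Finset.prod_const, Nat.cast_pow,
      Nat.cast_ofNat, Nat.cast_one, ← mul_pow]
    norm_num
  rw [mul_sub, ← h1, h2, h0]
  ring

/-- Correlations over the Clifford group: since a quarter of all transvections fix `P_p` and move
`P_q`, the pair `(P_p, P_q)` has a large orbit, so that a product of functions with small sum over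
the Pauli operators has a small average. -/
theorem cliffordSum_pair_le {g : Op n → ℝ} (hg : ∀ X, g (-X) = g X) (hg0 : ∀ X, 0 ≤ g X)
    {p q : PauliIdx n} (hp : p ≠ 0) (hq : q ≠ 0) (hpq : p ≠ q) :
    (4 : ℝ) ^ n * cliffordSum (fun X Y => g X * g Y) p q
      ≤ 4 * (∑ r : PauliIdx n, g (pauli r)) * cliffordSum (fun X _ => g X) p p := by
  set H := Finset.univ.filter fun h => sgn p h = 1 ∧ sgn q h = -1 with hH
  have hcard : (4 : ℝ) * H.card = 4 ^ n := by
    exact_mod_cast card_commute_anticommute hp hq hpq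
  have hinv : ∀ h ∈ H, cliffordSum (fun X Y => g X * g Y) p (pxor h q)
      = cliffordSum (fun X Y => g X * g Y) p q := by
    intro h hh
    obtain ⟨h1, h2⟩ := (Finset.mem_filter.1 hh).2
    have := cliffordSum_transvect (F := fun X Y => g X * g Y) (fun X Y => by rw [hg])
      (fun X Y => by rw [hg]) h p q
    rwa [transvect, transvect, sgn_comm h p, if_pos h1, sgn_comm h q, if_neg (by rw [h2]; norm_num)]
      at this
  -- the transvections along `H` move `q` to distinct places
  have hsum : H.card * cliffordSum (fun X Y => g X * g Y) p q
      ≤ ∑ r, cliffordSum (fun X Y => g X * g Y) p r := by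
    rw [← nsmul_eq_mul, ← Finset.sum_const, ← Finset.sum_congr rfl hinv,
      ← Finset.sum_image (f := fun r => cliffordSum (fun X Y => g X * g Y) p r)
        (g := fun h => pxor h q) fun a _ b _ hab => pxor_left_injective q hab]
    exact Finset.sum_le_sum_of_subset_of_nonneg (Finset.subset_univ _) fun r _ _ =>
      Finset.sum_nonneg fun α _ => mul_nonneg (hg0 _) (hg0 _)
  have htot : ∑ r, cliffordSum (fun X Y => g X * g Y) p r
      = (∑ r : PauliIdx n, g (pauli r)) * cliffordSum (fun X _ => g X) p p := by
    unfold cliffordSum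
    rw [Finset.sum_comm, Finset.mul_sum]
    refine Finset.sum_congr rfl fun α _ => ?_
    rw [← Finset.mul_sum, sum_symm_pauli hg, mul_comm]
  rw [← hcard, mul_assoc, mul_assoc, ← htot]
  linarith

end CliffordMoments

/-! ### Random Clifford measurements -/

section CliffordShadow

variable {n : ℕ}

theorem trace_ketBra_pairVec {c : ℂ} (hc : ‖c‖ = 1) {j k : Label n} (hjk : j ≠ k) :
    (ketBra (pairVec c j k)).trace = 1 := by
  have h := trace_ketBra_pairVec_mul c j k 1
  have hcc : star c * c = 1 := by
    rw [Complex.star_def, ← Complex.normSq_eq_conj_mul_self, Complex.normSq_eq_norm_sq, hc]; simp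
  rw [mul_one, hcc] at h
  rw [h]
  simp [hjk, hjk.symm]
  norm_num

theorem isDensity_ketBra_pairVec {c : ℂ} (hc : ‖c‖ = 1) {j k : Label n} (hjk : j ≠ k) :
    IsDensity (ketBra (pairVec c j k)) :=
  ⟨Matrix.posSemidef_vecMulVec_self_star _, trace_ketBra_pairVec hc hjk⟩

theorem norm_trace_ketBra_pairVec_mul_le {c : ℂ} (hc : ‖c‖ = 1) (j k : Label n) (A : Op n) :
    ‖(ketBra (pairVec c j k) * A).trace‖
      ≤ 1 / 2 * (‖A j j‖ + ‖A j k‖ + ‖A k j‖ + ‖A k k‖) := by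
  rw [trace_ketBra_pairVec_mul, norm_mul]
  have h1 : ‖(1 / 2 : ℂ)‖ = 1 / 2 := by simp
  rw [h1]
  refine mul_le_mul_of_nonneg_left ?_ (by norm_num)
  refine (norm_add_le _ _).trans (add_le_add ((norm_add_le _ _).trans (add_le_add
    ((norm_add_le _ _).trans (add_le_add le_rfl ?_)) ?_)) ?_) <;>
  simp [hc]

theorem norm_trace_ketBra_pairVec_mul_pauli_le {c : ℂ} (hc : ‖c‖ = 1) (j k : Label n)
    (p : PauliIdx n) : ‖(ketBra (pairVec c j k) * pauli p).trace‖ ≤ 2 := by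
  have := norm_trace_ketBra_pairVec_mul_le hc j k (pauli p)
  linarith [norm_pauli_apply_le p j j, norm_pauli_apply_le p j k, norm_pauli_apply_le p k j,
    norm_pauli_apply_le p k k]

/-- The Pauli expectation values of a pair state have small `ℓ¹` norm (for a general pure state it
can be of order `d^(3/2)`). -/
theorem sum_norm_trace_ketBra_pairVec_mul_pauli_le {c : ℂ} (hc : ‖c‖ = 1) (j k : Label n) :
    ∑ p : PauliIdx n, ‖(ketBra (pairVec c j k) * pauli p).trace‖ ≤ 2 * 2 ^ n := by
  refine (Finset.sum_le_sum fun p _ =>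
    norm_trace_ketBra_pairVec_mul_le hc j k (pauli p)).trans ?_
  rw [← Finset.mul_sum]
  simp only [Finset.sum_add_distrib, sum_norm_pauli_apply]
  linarith

theorem Clifford.trace_mul_symm (α : Clifford n) (A B : Op n) :
    (A * α.1.symm B).trace = (α.1 A * B).trace := by
  obtain ⟨α, U, hU, rfl⟩ := α
  simp only [Unitary.conjStarAlgAut_symm_apply, Unitary.conjStarAlgAut_apply]
  rw [← mul_assoc, ← mul_assoc, Matrix.trace_mul_comm]
  simp only [mul_assoc]

theorem Clifford.isDensity (α : Clifford n) {ρ : Op n} (h : IsDensity ρ) : IsDensity (α.1 ρ) := by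
  obtain ⟨α, U, hU, rfl⟩ := α
  exact h.conjStarAlgAut U

theorem trace_mul_basisProj (A : Op n) (b : Label n) : (A * basisProj b).trace = A b b := by
  rw [basisProj, Matrix.trace_mul_single]; simp

theorem trace_mul_snapshot_clifford {O : Op n} (hO : O.trace = 1) (α : Clifford n) (b : Label n) :
    (O * snapshot (cliffordScheme n) (α, b)).trace = (dim n + 1) * α.1 O b b - 1 := by
  have h1 : (α.1.symm (basisProj b)).trace = 1 := by
    have := α.trace_mul_symm 1 (basisProj b)
    rw [one_mul, map_one, one_mul] at this
    rw [this, ← one_mul (basisProj b), trace_mul_basisProj, Matrix.one_apply_eq]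
  simp only [snapshot, cliffordScheme, h1, one_smul]
  rw [mul_sub, mul_one, Matrix.trace_sub, hO, mul_smul_comm, Matrix.trace_smul,
    Clifford.trace_mul_symm, trace_mul_basisProj, smul_eq_mul]

theorem two_le_dim (hn : 1 ≤ n) : 2 ≤ dim n := by
  unfold dim
  calc (2 : ℝ) = 2 ^ 1 := by norm_num
    _ ≤ 2 ^ n := pow_le_pow_right₀ (by norm_num) hn

theorem card_clifford_pos : 0 < (Fintype.card (Clifford n) : ℝ) := by
  have : Nonempty (Clifford n) :=
    ⟨⟨Unitary.conjStarAlgAut ℂ (Op n) (transvection 0), _, isClifford_transvection 0, rfl⟩⟩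
  exact_mod_cast Fintype.card_pos

/-- The second-order moment of random Clifford measurements (the 2-design property). -/
theorem sum_clifford_diag_mul_diag (hn : 1 ≤ n) {ρ O : Op n} (hρ : IsDensity ρ)
    (hO : IsDensity O) :
    (dim n + 1) * ∑ α : Clifford n, ∑ b, (α.1 ρ b b).re * (α.1 O b b).re
      = Fintype.card (Clifford n) * (1 + (O * ρ).trace.re) := by
  set c : ℝ := (Fintype.card (Clifford n) : ℝ) with hc
  set Y : ℝ := ∑ α : Clifford n, ∑ b, (α.1 ρ b b).re * (α.1 O b b).re with hY
  set F : Op n → ℂ := fun X => (ρ * X).trace * (O * X).trace with hF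
  have hFneg : ∀ X, F (-X) = F X := fun X => by simp [hF]
  have hd := two_le_dim hn
  have h2 : (2 : ℂ) ^ n = ((dim n : ℝ) : ℂ) := by simp [dim]
  have hF1 : F 1 = 1 := by simp [hF, hρ.2, hO.2]
  have hYF : (dim n : ℂ) * (Y : ℂ)
      = ∑ z : Label n, cliffordSum (fun X _ => F X) (zIdx z) (zIdx z) := by
    unfold cliffordSum
    rw [Finset.sum_comm, hY]
    push_cast
    rw [Finset.mul_sum]
    refine Finset.sum_congr rfl fun α _ => ?_
    have h3 := sum_diag_mul_diag (α.1 ρ) (α.1 O)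
    simp only [← Clifford.trace_mul_symm] at h3
    rw [← h2, ← h3]
    congr 1
    refine Finset.sum_congr rfl fun b _ => ?_
    rw [← (α.isDensity hρ).diag_eq_re b, ← (α.isDensity hO).diag_eq_re b]
  have hz : ∀ z : Label n, z ≠ 0 → ((dim n : ℂ) * dim n - 1) *
      cliffordSum (fun X _ => F X) (zIdx z) (zIdx z) = c * (dim n * (O * ρ).trace - 1) := by
    intro z hz
    have h3 := cliffordSum_single hFneg (p := zIdx z) fun h => hz (zIdx_eq_zero.1 h)
    rw [hF1, sum_trace_pauli_mul_trace_pauli, h2, Matrix.trace_mul_comm ρ O] at h3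
    rw [h3, hc]
    simp
  have h0 : cliffordSum (fun X _ => F X) (zIdx (0 : Label n)) (zIdx 0) = c := by
    simp [cliffordSum, zIdx_zero, pauli_zero, hF1, hc]
  have hall : ((dim n : ℂ) * dim n - 1) * (dim n * Y)
      = ((dim n : ℂ) * dim n - 1) * c + (dim n - 1) * (c * (dim n * (O * ρ).trace - 1)) := by
    rw [hYF, ← Finset.add_sum_erase _ _ (Finset.mem_univ (0 : Label n)), h0, mul_add,
      Finset.mul_sum, Finset.sum_congr rfl fun z hz' => hz z (Finset.ne_of_mem_erase hz'),
      Finset.sum_const, Finset.card_erase_of_mem (Finset.mem_univ _), nsmul_eq_mul,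
      Nat.cast_sub (by simp [Nat.one_le_iff_ne_zero])]
    congr 2
    simp [h2.symm]
  have hre : (dim n * dim n - 1) * (dim n * Y)
      = (dim n * dim n - 1) * c + (dim n - 1) * (c * (dim n * (O * ρ).trace.re - 1)) := by
    have := congrArg Complex.re hall
    have e1 : ((dim n : ℂ) * dim n - 1) * (dim n * Y)
        = (((dim n * dim n - 1) * (dim n * Y) : ℝ) : ℂ) := by push_cast; ring
    have e2 : ((dim n : ℂ) * dim n - 1) * c + (dim n - 1) * (c * (dim n * (O * ρ).trace - 1))
        = (((dim n * dim n - 1) * c - (dim n - 1) * c : ℝ) : ℂ)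
          + (((dim n - 1) * c * dim n : ℝ) : ℂ) * (O * ρ).trace := by push_cast; ring
    rw [e1, e2, Complex.ofReal_re, Complex.add_re, Complex.ofReal_re, Complex.re_ofReal_mul] at this
    rw [this]
    ring
  -- the common factor `d (d - 1)` of both sides
  have hne : (dim n - 1) * dim n ≠ 0 := by
    have : 0 < (dim n - 1) * dim n := by apply mul_pos <;> linarith
    exact this.ne'
  apply mul_left_cancel₀ hne
  linear_combination hre

/-- The correlations of the moduli of Pauli expectation values of a pair state over the Clifford
group. -/
theorem sum_clifford_sum_norm_sq_le (hn : 1 ≤ n) {c : ℂ} (hc : ‖c‖ = 1) {j k : Label n}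
    (hjk : j ≠ k) :
    ∑ α : Clifford n,
      (∑ z : Label n, ‖(ketBra (pairVec c j k) * α.1.symm (pauli (zIdx z))).trace‖) ^ 2
        ≤ 35 * Fintype.card (Clifford n) := by
  set O := ketBra (pairVec c j k) with hO
  set G : ℝ := (Fintype.card (Clifford n) : ℝ) with hG
  have hGpos : 0 < G := card_clifford_pos
  set g : Op n → ℝ := fun X => ‖(O * X).trace‖ with hg
  have hgneg : ∀ X, g (-X) = g X := fun X => by simp [hg]
  have hg0 : ∀ X, 0 ≤ g X := fun X => norm_nonneg _
  have hd := two_le_dim hn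
  have hdpos := dim_pos n
  have hΓ : ∑ p : PauliIdx n, g (pauli p) ≤ 2 * dim n :=
    sum_norm_trace_ketBra_pairVec_mul_pauli_le hc j k
  have hg1 : g 1 = 1 := by simp [hg, hO, trace_ketBra_pairVec hc hjk]
  have hg2 : ∀ (α : Clifford n) (p : PauliIdx n), g (α.1.symm (pauli p)) ≤ 2 := by
    intro α p
    obtain ⟨f, hf⟩ := α.exists_perm
    have : g (α.1.symm (pauli p)) = g (pauli (f p)) := by
      rcases hf p with h | h <;> rw [h]
      rw [hgneg]
    rw [this]
    exact norm_trace_ketBra_pairVec_mul_pauli_le hc j k _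
  -- `8 / (3 d)` and `22 / d²` come from `d² - 1 ≥ 3 d² / 4`, valid since `d ≥ 2`
  have hS1 : ∀ p : PauliIdx n, p ≠ 0 →
      cliffordSum (fun X _ => g X) p p ≤ G * (8 / 3 / dim n) := by
    intro p hp
    have h1 : (dim n * dim n - 1) * cliffordSum (fun X _ => g X) p p
        = G * (∑ q : PauliIdx n, g (pauli q) - g 1) := cliffordSum_single hgneg hp
    have h2 : (dim n * dim n - 1) * cliffordSum (fun X _ => g X) p p ≤ G * (2 * dim n) := by
      rw [h1, hg1]
      exact mul_le_mul_of_nonneg_left (by linarith) hGpos.le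
    have h3 : 0 ≤ cliffordSum (fun X _ => g X) p p := Finset.sum_nonneg fun α _ => hg0 _
    have h4 : 3 / 4 * (dim n * dim n) ≤ dim n * dim n - 1 := by nlinarith
    have h5 := (mul_le_mul_of_nonneg_right h4 h3).trans h2
    rw [← mul_div_assoc, le_div_iff₀ hdpos]
    have h6 : dim n * (3 / 4 * (cliffordSum (fun X _ => g X) p p * dim n))
        ≤ dim n * (2 * G) := by linarith
    linarith [le_of_mul_le_mul_left h6 hdpos]
  have hS2 : ∀ p q : PauliIdx n, p ≠ 0 → q ≠ 0 → p ≠ q →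
      cliffordSum (fun X Y => g X * g Y) p q ≤ G * (22 / dim n ^ 2) := by
    intro p q hp hq hpq
    have h1 := cliffordSum_pair_le hgneg hg0 hp hq hpq
    have h4 : (4 : ℝ) ^ n = dim n ^ 2 := by
      rw [dim, ← pow_mul, mul_comm, pow_mul]; norm_num
    have h3 : 0 ≤ cliffordSum (fun X _ => g X) p p := Finset.sum_nonneg fun α _ => hg0 _
    rw [h4] at h1
    have h5 : 4 * (∑ r : PauliIdx n, g (pauli r)) * cliffordSum (fun X _ => g X) p p
        ≤ 4 * (2 * dim n) * (G * (8 / 3 / dim n)) :=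
      mul_le_mul (by linarith) (hS1 p hp) h3 (by linarith)
    have h6 : 4 * (2 * dim n) * (G * (8 / 3 / dim n)) = 64 / 3 * G := by field_simp; norm_num
    rw [← mul_div_assoc, le_div_iff₀ (by positivity)]
    linarith
  -- one bound for all pairs: the identity pair, one identity factor, equal factors, generic pairs
  have hpair : ∀ z w : Label n, cliffordSum (fun X Y => g X * g Y) (zIdx z) (zIdx w)
      ≤ G * ((if z = 0 then (if w = 0 then 1 else 0) else 0) + (if z = 0 then 8 / 3 / dim n else 0)
        + (if w = 0 then 8 / 3 / dim n else 0) + (if z = w then 16 / 3 / dim n else 0)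
        + 22 / dim n ^ 2) := by
    intro z w
    have e1 : 0 < 8 / 3 / dim n := by positivity
    have e2 : 0 < 16 / 3 / dim n := by positivity
    have e3 : 0 < 22 / dim n ^ 2 := by positivity
    have hsym : ∀ α : Clifford n, g (α.1.symm (pauli 0)) = 1 := fun α => by
      rw [pauli_zero, map_one, hg1]
    by_cases hz : z = 0
    · by_cases hw : w = 0
      · subst hz hw
        have : cliffordSum (fun X Y => g X * g Y) (zIdx (0 : Label n)) (zIdx 0) = G := by
          simp [cliffordSum, zIdx_zero, hsym, hG]
        rw [this]
        simp only [if_true]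
        exact le_mul_of_one_le_right hGpos.le (by linarith)
      · have : cliffordSum (fun X Y => g X * g Y) (zIdx z) (zIdx w)
            = cliffordSum (fun X _ => g X) (zIdx w) (zIdx w) := by
          simp [cliffordSum, hz, zIdx_zero, hsym]
        rw [this]
        refine (hS1 _ fun h => hw (zIdx_eq_zero.1 h)).trans
          (mul_le_mul_of_nonneg_left ?_ hGpos.le)
        simp only [hz, hw, if_true, if_false]
        split_ifs <;> linarith
    · by_cases hw : w = 0
      · have : cliffordSum (fun X Y => g X * g Y) (zIdx z) (zIdx w)
            = cliffordSum (fun X _ => g X) (zIdx z) (zIdx z) := by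
          simp [cliffordSum, hw, zIdx_zero, hsym]
        rw [this]
        refine (hS1 _ fun h => hz (zIdx_eq_zero.1 h)).trans
          (mul_le_mul_of_nonneg_left ?_ hGpos.le)
        simp only [hz, hw, if_true, if_false]
        linarith
      · by_cases hzw : z = w
        · subst hzw
          have h1 : cliffordSum (fun X Y => g X * g Y) (zIdx z) (zIdx z)
              ≤ 2 * cliffordSum (fun X _ => g X) (zIdx z) (zIdx z) := by
            unfold cliffordSum
            rw [Finset.mul_sum]
            exact Finset.sum_le_sum fun α _ => mul_le_mul_of_nonneg_right (hg2 α _) (hg0 _)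
          have h2 := hS1 _ fun h => hz (zIdx_eq_zero.1 h)
          have h3 : 2 * (G * (8 / 3 / dim n)) = G * (16 / 3 / dim n) := by ring
          refine (h1.trans (by linarith : _ ≤ G * (16 / 3 / dim n))).trans
            (mul_le_mul_of_nonneg_left ?_ hGpos.le)
          simp only [hz, if_true, if_false]
          linarith
        · refine (hS2 _ _ (fun h => hz (zIdx_eq_zero.1 h)) (fun h => hw (zIdx_eq_zero.1 h))
            fun h => hzw (zIdx_injective h)).trans (le_of_eq ?_)
          simp [hz, hw, hzw]
  have hexp : ∑ α : Clifford n, (∑ z : Label n, g (α.1.symm (pauli (zIdx z)))) ^ 2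
      = ∑ z : Label n, ∑ w : Label n, cliffordSum (fun X Y => g X * g Y) (zIdx z) (zIdx w) := by
    unfold cliffordSum
    simp only [sq, Finset.sum_mul_sum]
    rw [Finset.sum_comm]
    exact Finset.sum_congr rfl fun z _ => Finset.sum_comm
  change ∑ α : Clifford n, (∑ z : Label n, g (α.1.symm (pauli (zIdx z)))) ^ 2 ≤ 35 * G
  rw [hexp]
  refine (Finset.sum_le_sum fun z _ => Finset.sum_le_sum fun w _ => hpair z w).trans ?_
  simp only [← Finset.mul_sum, Finset.sum_add_distrib, Finset.sum_ite_eq, Finset.sum_ite_eq',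
    Finset.mem_univ, if_true, Finset.sum_const, Finset.card_univ, nsmul_eq_mul, card_label,
    Finset.sum_ite_irrel, mul_zero]
  rw [mul_comm 35 G]
  refine mul_le_mul_of_nonneg_left ?_ hGpos.le
  rw [show 1 + dim n * (8 / 3 / dim n) + dim n * (8 / 3 / dim n) + dim n * (16 / 3 / dim n)
    + dim n * (dim n * (22 / dim n ^ 2)) = 101 / 3 by field_simp; norm_num]
  norm_num

/-- The snapshots of random Clifford measurements estimate pair states without bias and with
bounded second moment. -/
theorem isShadow_cliffordScheme (hn : 1 ≤ n) : (cliffordScheme n).IsShadow 80 where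
  weight_nonneg _ := by simp only [cliffordScheme]; positivity
  sum_weight := by
    have := (card_clifford_pos (n := n)).ne'
    simp [cliffordScheme, this]
  evolve_density α ρ hρ := α.isDensity hρ
  mean_eq ρ hρ c hc j k hjk := by
    set O := ketBra (pairVec c j k)
    have hO := isDensity_ketBra_pairVec hc hjk
    have hG := (card_clifford_pos (n := n)).ne'
    have h1 : ∀ (α : Clifford n) b, (O * snapshot (cliffordScheme n) (α, b)).trace.re
        = (dim n + 1) * (α.1 O b b).re - 1 := fun α b => by
      rw [trace_mul_snapshot_clifford hO.2,
        show ((dim n : ℂ) + 1) = ((dim n + 1 : ℝ) : ℂ) by push_cast; ring,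
        Complex.sub_re, Complex.re_ofReal_mul, Complex.one_re]
    simp only [h1]
    have h2 : ∀ α : Clifford n, ∑ b, (cliffordScheme n).weight α *
        ((cliffordScheme n).evolve α ρ b b).re * ((dim n + 1) * (α.1 O b b).re - 1)
        = 1 / (Fintype.card (Clifford n) : ℝ) *
          ((dim n + 1) * (∑ b, (α.1 ρ b b).re * (α.1 O b b).re) - 1) := fun α => by
      have h3 : (dim n + 1) * (∑ b, (α.1 ρ b b).re * (α.1 O b b).re) - 1
          = ∑ b, (α.1 ρ b b).re * ((dim n + 1) * (α.1 O b b).re - 1) := by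
        simp only [mul_sub, mul_one, Finset.sum_sub_distrib, (α.isDensity hρ).sum_diag_re,
          Finset.mul_sum, mul_left_comm]
      rw [h3, Finset.mul_sum]
      exact Finset.sum_congr rfl fun b _ => by simp only [cliffordScheme]; ring
    simp only [h2]
    rw [← Finset.mul_sum, Finset.sum_sub_distrib, ← Finset.mul_sum,
      sum_clifford_diag_mul_diag hn hρ hO]
    simp only [Finset.sum_const, Finset.card_univ, nsmul_eq_mul, mul_one]
    field_simp
    ring
  second_le ρ hρ c hc j k hjk := by
    set O := ketBra (pairVec c j k)
    have hO := isDensity_ketBra_pairVec hc hjk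
    have hG := card_clifford_pos (n := n)
    have hd := two_le_dim hn
    have hdpos := dim_pos n
    have h1 : ∀ (α : Clifford n) b, (O * snapshot (cliffordScheme n) (α, b)).trace.re
        = (dim n + 1) * (α.1 O b b).re - 1 := fun α b => by
      rw [trace_mul_snapshot_clifford hO.2,
        show ((dim n : ℂ) + 1) = ((dim n + 1 : ℝ) : ℂ) by push_cast; ring,
        Complex.sub_re, Complex.re_ofReal_mul, Complex.one_re]
    simp only [h1]
    set T : Clifford n → ℝ := fun α =>
      ∑ z : Label n, ‖(O * α.1.symm (pauli (zIdx z))).trace‖ with hT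
    have hdiag : ∀ (α : Clifford n) b, (dim n + 1) * (α.1 O b b).re ≤ 3 / 2 * T α := by
      intro α b
      have h2 : dim n * ‖α.1 O b b‖ ≤ T α := by
        have := norm_diag_le (α.1 O) b
        simp only [← Clifford.trace_mul_symm] at this
        exact this
      have h3 := Complex.re_le_norm (α.1 O b b)
      have h4 := (α.isDensity hO).diag_re_nonneg b
      nlinarith
    have hX : ∀ (α : Clifford n) b,
        ((dim n + 1) * (α.1 O b b).re - 1) ^ 2 ≤ 9 / 4 * T α ^ 2 + 1 := by
      intro α b
      have h4 : 0 ≤ (dim n + 1) * (α.1 O b b).re :=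
        mul_nonneg (by linarith) ((α.isDensity hO).diag_re_nonneg b)
      have h5 := pow_le_pow_left₀ h4 (hdiag α b) 2
      nlinarith
    have h2 : ∀ α : Clifford n, ∑ b, (cliffordScheme n).weight α *
        ((cliffordScheme n).evolve α ρ b b).re * ((dim n + 1) * (α.1 O b b).re - 1) ^ 2
        ≤ 1 / (Fintype.card (Clifford n) : ℝ) * (9 / 4 * T α ^ 2 + 1) := fun α => by
      have h3 : ∑ b, (α.1 ρ b b).re * (9 / 4 * T α ^ 2 + 1) = 9 / 4 * T α ^ 2 + 1 := by
        rw [← Finset.sum_mul, (α.isDensity hρ).sum_diag_re, one_mul]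
      rw [← h3, Finset.mul_sum]
      refine Finset.sum_le_sum fun b _ => ?_
      simp only [cliffordScheme]
      rw [mul_assoc]
      exact mul_le_mul_of_nonneg_left (mul_le_mul_of_nonneg_left (hX α b)
        ((α.isDensity hρ).diag_re_nonneg b)) (by positivity)
    refine (Finset.sum_le_sum fun α _ => h2 α).trans ?_
    rw [← Finset.mul_sum, Finset.sum_add_distrib, ← Finset.mul_sum]
    simp only [Finset.sum_const, Finset.card_univ, nsmul_eq_mul, mul_one]
    have h3 := sum_clifford_sum_norm_sq_le hn hc hjk
    rw [one_div, inv_mul_le_iff₀ hG]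
    change ∑ α, T α ^ 2 ≤ _ at h3
    linarith

end CliffordShadow

/-! ### Biased measurements of mutually unbiased bases -/

section FramePotential

variable {κ I : Type*} [Fintype κ] [Fintype I]

theorem sum_four_mul {R : Type*} [CommRing R] (f g h l : κ → R) :
    ∑ a, ∑ b, ∑ c, ∑ e, f a * g b * h c * l e
      = (∑ a, f a) * (∑ b, g b) * (∑ c, h c) * ∑ e, l e := by
  simp only [← Finset.mul_sum, ← Finset.sum_mul]

theorem sum_four_comm {R : Type*} [CommRing R] (F : I → κ → κ → κ → κ → R) :
    ∑ a, ∑ b, ∑ c, ∑ e, ∑ i, F i a b c e = ∑ i, ∑ a, ∑ b, ∑ c, ∑ e, F i a b c e := by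
  simp only [Finset.sum_comm (s := (Finset.univ : Finset κ)) (t := (Finset.univ : Finset I))]

variable [DecidableEq κ]

/-- The tensor `1 + SWAP` in coordinates. -/
def symTensor (a b c e : κ) : ℂ :=
  (if a = b then if c = e then 1 else 0 else 0) + if a = e then if c = b then 1 else 0 else 0

theorem sum_symTensor_mul (X : κ → κ → κ → κ → ℂ) :
    ∑ a, ∑ b, ∑ c, ∑ e, symTensor a b c e * X a b c e
      = ∑ a, ∑ c, X a a c c + ∑ a, ∑ c, X a c c a := by
  simp only [symTensor, add_mul, ite_mul, one_mul, zero_mul, Finset.sum_add_distrib]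
  congr 1
  · refine Finset.sum_congr rfl fun a _ => ?_
    rw [Finset.sum_eq_single a (fun b _ hb => by simp [hb.symm]) (by simp)]
    simp
  · refine Finset.sum_congr rfl fun a _ => Finset.sum_congr rfl fun b _ => ?_
    rw [Finset.sum_eq_single b (fun c _ hc => by simp [hc]) (by simp)]
    simp

/-- A family of unit vectors whose frame potential attains the Welch bound is a 2-design:
`∑_i (|ψ_i⟩⟨ψ_i|)^{⊗2} = 1 + SWAP`, written in coordinates. The hypotheses say that the
Hilbert–Schmidt norm of the difference of the two sides vanishes. -/
theorem sum_tensor_eq_of_framePotential (ψ : I → κ → ℂ)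
    (hunit : ∀ i, ∑ a, ψ i a * star (ψ i a) = 1)
    (hpot : ∀ i, ∑ i', ‖∑ a, ψ i a * star (ψ i' a)‖ ^ 4 = 2)
    (hcard : Fintype.card I = Fintype.card κ * (Fintype.card κ + 1)) (a b c e : κ) :
    ∑ i, ψ i a * star (ψ i b) * ψ i c * star (ψ i e)
      = symTensor a b c e := by
  set t : I → κ → κ → κ → κ → ℂ := fun i a b c e =>
    ψ i a * star (ψ i b) * ψ i c * star (ψ i e) with ht
  set D : κ → κ → κ → κ → ℂ := fun a b c e => ∑ i, t i a b c e - symTensor a b c e with hD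
  have htt : ∀ i i', ∑ a, ∑ b, ∑ c, ∑ e, star (t i a b c e) * t i' a b c e
      = ((‖∑ a, ψ i a * star (ψ i' a)‖ ^ 4 : ℝ) : ℂ) := by
    intro i i'
    have h1 : ∀ a b c e, star (t i a b c e) * t i' a b c e
        = (star (ψ i a) * ψ i' a) * (ψ i b * star (ψ i' b)) * (star (ψ i c) * ψ i' c) *
          (ψ i e * star (ψ i' e)) := fun a b c e => by
      simp only [ht, star_mul', star_star]; ring
    simp only [h1]
    rw [sum_four_mul fun a => star (ψ i a) * ψ i' a]
    have h2 : ∑ a, star (ψ i a) * ψ i' a = star (∑ a, ψ i a * star (ψ i' a)) := by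
      rw [star_sum]
      exact Finset.sum_congr rfl fun a _ => by rw [star_mul', star_star]
    rw [h2]
    set G := ∑ a, ψ i a * star (ψ i' a)
    have h3 : star G * G = ((‖G‖ ^ 2 : ℝ) : ℂ) := by
      rw [Complex.star_def, ← Complex.normSq_eq_conj_mul_self, Complex.normSq_eq_norm_sq]
    calc star G * G * star G * G = (star G * G) * (star G * G) := by ring
      _ = _ := by rw [h3, ← Complex.ofReal_mul]; congr 1; ring
  have hrt : ∀ i, ∑ a, ∑ b, ∑ c, ∑ e, symTensor a b c e * t i a b c e = 2 := by
    intro i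
    have h1 : ∀ a c, t i a a c c = (ψ i a * star (ψ i a)) * (ψ i c * star (ψ i c)) :=
      fun a c => by simp only [ht]; ring
    have h2 : ∀ a c, t i a c c a = (ψ i a * star (ψ i a)) * (ψ i c * star (ψ i c)) :=
      fun a c => by simp only [ht]; ring
    rw [sum_symTensor_mul]
    simp only [h1, h2, ← Finset.mul_sum, hunit, mul_one]
    norm_num
  have hrr : ∑ a : κ, ∑ b : κ, ∑ c : κ, ∑ e : κ, symTensor a b c e * symTensor a b c e
      = 2 * ((Fintype.card κ : ℂ) * (Fintype.card κ + 1)) := by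
    rw [sum_symTensor_mul]
    have h1 : ∀ a : κ, ∑ c, symTensor a a c c = (Fintype.card κ : ℂ) + 1 := fun a => by
      have : ∀ c, symTensor a a c c = 1 + if a = c then 1 else 0 := fun c => by
        by_cases h : a = c <;> simp [symTensor, h]
      simp [this, Finset.sum_add_distrib]
    have h2 : ∀ a : κ, ∑ c, symTensor a c c a = (Fintype.card κ : ℂ) + 1 := fun a => by
      have : ∀ c, symTensor a c c a = 1 + if a = c then 1 else 0 := fun c => by
        by_cases h : a = c <;> simp [symTensor, h, add_comm]
      simp [this, Finset.sum_add_distrib]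
    simp only [h1, h2, Finset.sum_const, Finset.card_univ, nsmul_eq_mul]
    ring
  -- `‖T‖² - 2 ⟨1 + SWAP, T⟩ + ‖1 + SWAP‖² = 2 k (k + 1) - 4 k (k + 1) + 2 k (k + 1) = 0`, where
  -- `k` is the dimension
  have hDD : ∑ a, ∑ b, ∑ c, ∑ e, star (D a b c e) * D a b c e = 0 := by
    have hrstar : ∀ a b c e : κ, star (symTensor a b c e) = symTensor a b c e :=
      fun a b c e => by simp only [symTensor, star_add]; split_ifs <;> simp
    have h1 : ∀ a b c e, star (D a b c e) * D a b c e
        = ∑ i, ∑ i', star (t i a b c e) * t i' a b c e - ∑ i, star (symTensor a b c e * t i a b c e)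
          - ∑ i, symTensor a b c e * t i a b c e
          + symTensor a b c e * symTensor a b c e := fun a b c e => by
      simp only [hD, star_sub, star_sum, hrstar, star_mul', ← Finset.mul_sum]
      rw [← Finset.sum_mul]
      ring
    simp only [h1, Finset.sum_add_distrib, Finset.sum_sub_distrib]
    rw [sum_four_comm fun i a b c e => ∑ i', star (t i a b c e) * t i' a b c e,
      sum_four_comm fun i a b c e => star (symTensor a b c e * t i a b c e),
      sum_four_comm fun i a b c e => symTensor a b c e * t i a b c e, hrr]
    have h2 : ∀ i, ∑ a, ∑ b, ∑ c, ∑ e, ∑ i', star (t i a b c e) * t i' a b c e = 2 := fun i => by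
      rw [sum_four_comm fun i' a b c e => star (t i a b c e) * t i' a b c e]
      simp only [htt]
      rw [← Complex.ofReal_sum, hpot]
      norm_num
    have h3 : ∀ i, ∑ a, ∑ b, ∑ c, ∑ e, star (symTensor a b c e * t i a b c e) = 2 := fun i => by
      simp only [← star_sum, hrt]
      simp
    simp only [h2, h3, hrt, Finset.sum_const, Finset.card_univ, hcard, nsmul_eq_mul]
    push_cast
    ring
  have hreal : ∑ a, ∑ b, ∑ c, ∑ e, ‖D a b c e‖ ^ 2 = 0 := by
    have h1 : ∀ z : ℂ, star z * z = ((‖z‖ ^ 2 : ℝ) : ℂ) := fun z => by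
      rw [Complex.star_def, ← Complex.normSq_eq_conj_mul_self, Complex.normSq_eq_norm_sq]
    simp only [h1, ← Complex.ofReal_sum] at hDD
    exact_mod_cast hDD
  have hle : ‖D a b c e‖ ^ 2 ≤ ∑ a, ∑ b, ∑ c, ∑ e, ‖D a b c e‖ ^ 2 := by
    refine le_trans ?_ (Finset.single_le_sum (f := fun a => ∑ b, ∑ c, ∑ e, ‖D a b c e‖ ^ 2)
      (fun _ _ => by positivity) (Finset.mem_univ a))
    refine le_trans ?_ (Finset.single_le_sum (f := fun b => ∑ c, ∑ e, ‖D a b c e‖ ^ 2)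
      (fun _ _ => by positivity) (Finset.mem_univ b))
    refine le_trans ?_ (Finset.single_le_sum (f := fun c => ∑ e, ‖D a b c e‖ ^ 2)
      (fun _ _ => by positivity) (Finset.mem_univ c))
    exact Finset.single_le_sum (f := fun e => ‖D a b c e‖ ^ 2)
      (fun _ _ => by positivity) (Finset.mem_univ e)
  have h0 : ‖D a b c e‖ = 0 := by
    rw [hreal] at hle
    exact pow_eq_zero_iff (two_ne_zero) |>.1 (le_antisymm hle (by positivity))
  exact sub_eq_zero.1 (norm_eq_zero.1 h0)

end FramePotential

section MUB

variable {n : ℕ} {U : Fin (2 ^ n + 1) → unitary (Op n)}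

theorem evolve_apply_diag (V : unitary (Op n)) (A : Op n) (b : Label n) :
    Unitary.conjStarAlgAut ℂ (Op n) V A b b
      = ∑ x, ∑ y, A x y * ((V : Op n) b x * star ((V : Op n) b y)) := by
  rw [Unitary.conjStarAlgAut_apply]
  simp only [Matrix.mul_apply, Matrix.star_apply, Finset.sum_mul]
  rw [Finset.sum_comm]
  exact Finset.sum_congr rfl fun x _ => Finset.sum_congr rfl fun y _ => by ring

/-- A complete set of mutually unbiased bases is a 2-design. -/
theorem IsCompleteMUB.sum_diag_mul_diag (hU : IsCompleteMUB U) (A B : Op n) :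
    ∑ i, ∑ b, Unitary.conjStarAlgAut ℂ (Op n) (U i) A b b *
        Unitary.conjStarAlgAut ℂ (Op n) (U i) B b b
      = (A * B).trace + A.trace * B.trace := by
  set ψ : Fin (2 ^ n + 1) × Label n → Label n → ℂ := fun p a => (U p.1 : Op n) p.2 a with hψ
  have hgram : ∀ p p', ∑ a, ψ p a * star (ψ p' a)
      = ((U p.1 : Op n) * star (U p'.1 : Op n)) p.2 p'.2 := fun p p' => by
    simp only [hψ, Matrix.mul_apply, Matrix.star_apply]
  have hsame : ∀ p b', ∑ a, ψ p a * star (ψ (p.1, b') a) = if p.2 = b' then 1 else 0 :=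
    fun p b' => by
      rw [hgram]
      change ((U p.1 : Op n) * star (U p.1 : Op n)) p.2 b' = _
      rw [Unitary.mul_star_self_of_mem (U p.1).2, Matrix.one_apply]
  have hdpos := dim_pos n
  have hT := sum_tensor_eq_of_framePotential ψ (fun p => by simpa using hsame p p.2)
    (fun p => by
      rw [Fintype.sum_prod_type, ← Finset.add_sum_erase _ _ (Finset.mem_univ p.1)]
      have h1 : ∑ b', ‖∑ a, ψ p a * star (ψ (p.1, b') a)‖ ^ 4 = 1 := by
        simp only [hsame]
        rw [Finset.sum_eq_single p.2 (fun b _ hb => by simp [hb.symm]) (by simp)]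
        simp
      have h2 : ∀ i ∈ Finset.univ.erase p.1,
          ∑ b', ‖∑ a, ψ p a * star (ψ (i, b') a)‖ ^ 4 = 1 / dim n := by
        intro i hi
        have h3 : ∀ b', ‖∑ a, ψ p a * star (ψ (i, b') a)‖ ^ 4 = (1 / dim n) ^ 2 := fun b' => by
          rw [hgram, ← hU.2 p.1 i (Finset.ne_of_mem_erase hi).symm p.2 b', ← pow_mul]
        simp only [h3, Finset.sum_const, Finset.card_univ, nsmul_eq_mul, card_label]
        field_simp
      rw [h1, Finset.sum_congr rfl h2, Finset.sum_const,
        Finset.card_erase_of_mem (Finset.mem_univ _)]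
      simp [dim]
      norm_num)
    (by simp [mul_comm])
  have hterm : ∀ i b, Unitary.conjStarAlgAut ℂ (Op n) (U i) A b b *
        Unitary.conjStarAlgAut ℂ (Op n) (U i) B b b
      = ∑ x, ∑ y, ∑ x', ∑ y', A x y * B x' y' *
        (ψ (i, b) x * star (ψ (i, b) y) * ψ (i, b) x' * star (ψ (i, b) y')) := fun i b => by
    rw [evolve_apply_diag, evolve_apply_diag]
    simp only [Finset.sum_mul]
    refine Finset.sum_congr rfl fun x _ => Finset.sum_congr rfl fun y _ => ?_
    simp only [Finset.mul_sum]
    exact Finset.sum_congr rfl fun x' _ => Finset.sum_congr rfl fun y' _ => by ring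
  simp only [hterm]
  rw [← Fintype.sum_prod_type' (f := fun i b => ∑ x, ∑ y, ∑ x', ∑ y', A x y * B x' y' *
        (ψ (i, b) x * star (ψ (i, b) y) * ψ (i, b) x' * star (ψ (i, b) y'))),
    ← sum_four_comm fun (p : Fin (2 ^ n + 1) × Label n) x y x' y' => A x y * B x' y' *
      (ψ (p.1, p.2) x * star (ψ (p.1, p.2) y) * ψ (p.1, p.2) x' * star (ψ (p.1, p.2) y'))]
  simp only [Prod.mk.eta, ← Finset.mul_sum, hT, mul_comm _ (symTensor _ _ _ _)]
  rw [sum_symTensor_mul fun x y x' y' => A x y * B x' y', add_comm]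
  simp only [Matrix.trace, Matrix.diag, Matrix.mul_apply, Finset.sum_mul_sum]

/-- The inverse of the measurement channel is self-adjoint. -/
theorem trace_mul_inv_mubScheme (O X : Op n) :
    (O * (mubScheme U).inv X).trace = 2 * dim n * ((O * X).trace
      - (dim n - 1) / dim n * ∑ k, X k k * O k k) - X.trace / dim n * O.trace := by
  simp only [mubScheme, mul_sub, Matrix.trace_sub, mul_smul_comm, Matrix.trace_smul, smul_eq_mul,
    Finset.mul_sum, Matrix.trace_sum, trace_mul_basisProj, mul_one]

theorem trace_mul_inv_mubScheme_comm (O X : Op n) :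
    (O * (mubScheme U).inv X).trace = ((mubScheme U).inv O * X).trace := by
  rw [Matrix.trace_mul_comm _ X, trace_mul_inv_mubScheme, trace_mul_inv_mubScheme,
    Matrix.trace_mul_comm O X]
  simp only [mul_comm (O _ _)]
  ring

theorem trace_mul_snapshot_mubScheme (O : Op n) (i : Fin (2 ^ n + 1)) (b : Label n) :
    (O * snapshot (mubScheme U) (i, b)).trace
      = Unitary.conjStarAlgAut ℂ (Op n) (U i) ((mubScheme U).inv O) b b := by
  rw [snapshot, trace_mul_inv_mubScheme_comm]
  refine Eq.trans ?_ (trace_mul_basisProj _ b)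
  simp only [mubScheme, Unitary.conjStarAlgAut_symm_apply, Unitary.conjStarAlgAut_apply]
  rw [← mul_assoc, ← mul_assoc, Matrix.trace_mul_comm]
  simp only [mul_assoc]

theorem sum_weight_mul_mubScheme (f : Fin (2 ^ n + 1) → ℂ) :
    ∑ i, ((mubScheme U).weight i : ℂ) * f i
      = 1 / 2 * f 0 + 1 / (2 * dim n) * (∑ i, f i - f 0) := by
  rw [Fin.sum_univ_succ, Fin.sum_univ_succ]
  simp only [mubScheme, if_true, Fin.succ_ne_zero, if_false, ← Finset.mul_sum, dim]
  push_cast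
  rw [pow_succ]
  ring

theorem weight_nonneg_mubScheme (i : Fin (2 ^ n + 1)) : 0 ≤ (mubScheme U).weight i := by
  simp only [mubScheme]; split_ifs <;> positivity

theorem sum_weight_mubScheme : ∑ i, (mubScheme U).weight i = 1 := by
  rw [Fin.sum_univ_succ]
  simp [mubScheme, Fin.succ_ne_zero, pow_succ]
  field_simp
  norm_num

theorem IsCompleteMUB.evolve_zero (hU : IsCompleteMUB U) (A : Op n) :
    Unitary.conjStarAlgAut ℂ (Op n) (U 0) A = A := by
  rw [hU.1, map_one]; rfl

/-- The measurement channel is inverted on states. -/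
theorem IsCompleteMUB.sum_mul_trace_snapshot (hU : IsCompleteMUB U) {ρ O : Op n}
    (hρ : ρ.trace = 1) (hO : O.trace = 1) :
    ∑ i, ((mubScheme U).weight i : ℂ) * ∑ b, Unitary.conjStarAlgAut ℂ (Op n) (U i) ρ b b *
        (O * snapshot (mubScheme U) (i, b)).trace = (O * ρ).trace := by
  have hd : (dim n : ℂ) ≠ 0 := by exact_mod_cast (dim_pos n).ne'
  simp only [trace_mul_snapshot_mubScheme]
  rw [sum_weight_mul_mubScheme, hU.sum_diag_mul_diag, Matrix.trace_mul_comm ρ,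
    ← trace_mul_inv_mubScheme_comm, trace_mul_inv_mubScheme]
  simp only [hU.evolve_zero]
  have htr : ((mubScheme U).inv O).trace = 1 := by
    have h1 := trace_mul_inv_mubScheme (U := U) 1 O
    rw [one_mul, one_mul] at h1
    have h2 : ∑ k, O k k * (1 : Op n) k k = O.trace := by simp [Matrix.trace]
    have h3 : (1 : Op n).trace = dim n := by simp [dim]
    rw [h1, h2, h3, hO]
    field_simp
    ring
  have hdiag : ∀ b, (mubScheme U).inv O b b = 2 * O b b - 1 / dim n := by
    intro b
    have h1 := trace_mul_inv_mubScheme (U := U) (basisProj b) O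
    have h2 : ∑ k, O k k * (basisProj b : Op n) k k = O b b := by
      rw [Finset.sum_eq_single b (fun c _ hc => by simp [basisProj, Matrix.single, hc.symm])
        (by simp)]
      simp [basisProj]
    have h3 : (basisProj b : Op n).trace = 1 := by
      rw [← one_mul (basisProj b), trace_mul_basisProj, Matrix.one_apply_eq]
    rw [Matrix.trace_mul_comm, trace_mul_basisProj, h2, h3, hO, Matrix.trace_mul_comm,
      trace_mul_basisProj] at h1
    rw [h1]
    field_simp
    ring
  have hsum : ∑ b, ρ b b * (mubScheme U).inv O b b = 2 * ∑ k, ρ k k * O k k - 1 / dim n := by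
    have h1 : ∑ b, ρ b b = 1 := hρ
    simp only [hdiag, mul_sub, Finset.sum_sub_distrib, ← Finset.sum_mul, h1, one_mul,
      Finset.mul_sum, mul_left_comm]
  rw [hsum, htr, hρ, hO]
  field_simp
  ring

/-- The vectors of the bases other than the computational one are flat, so every snapshot of a
pair state is bounded. -/
theorem IsCompleteMUB.abs_trace_mul_snapshot_le (hU : IsCompleteMUB U) {c : ℂ} (hc : ‖c‖ = 1)
    {j k : Label n} (hjk : j ≠ k) (i : Fin (2 ^ n + 1)) (b : Label n) :
    |(ketBra (pairVec c j k) * snapshot (mubScheme U) (i, b)).trace.re| ≤ 7 := by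
  set O := ketBra (pairVec c j k)
  have hO : IsDensity O := isDensity_ketBra_pairVec hc hjk
  have hdpos := dim_pos n
  have hd : (dim n : ℂ) ≠ 0 := by exact_mod_cast hdpos.ne'
  have hd1 : 1 ≤ dim n := one_le_pow₀ (by norm_num)
  refine (Complex.abs_re_le_norm _).trans ?_
  set X := ((mubScheme U).evolve i).symm (basisProj b) with hX
  have hsnap : snapshot (mubScheme U) (i, b) = (mubScheme U).inv X := rfl
  have hXapp : ∀ x y, X x y = star ((U i : Op n) b x) * (U i : Op n) b y := by
    intro x y
    have h1 : X = star (U i : Op n) * basisProj b * (U i : Op n) := by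
      rw [hX]
      simp only [mubScheme, Unitary.conjStarAlgAut_symm_apply]
    rw [h1, basisProj, Matrix.mul_apply,
      Finset.sum_eq_single b (fun z _ hz => by
        rw [Matrix.mul_single_apply_of_ne _ _ _ _ _ hz, zero_mul]) (by simp),
      Matrix.mul_single_apply_same, Matrix.star_apply, mul_one]
  have hXtr : X.trace = 1 := by
    have h2 : X.trace = ((U i : Op n) * star (U i : Op n)) b b := by
      rw [Matrix.mul_apply]
      simp only [Matrix.trace, Matrix.diag, hXapp, Matrix.star_apply]
      exact Finset.sum_congr rfl fun x _ => mul_comm _ _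
    rw [h2, Unitary.mul_star_self_of_mem (U i).2, Matrix.one_apply_eq]
  rw [hsnap, trace_mul_inv_mubScheme, hXtr, hO.2, mul_one]
  by_cases hi : i = 0
  · have hXb : X = basisProj b := by
      rw [hX, hi]
      simp only [mubScheme, Unitary.conjStarAlgAut_symm_apply, hU.1, OneMemClass.coe_one, star_one,
        one_mul, mul_one]
    have h2 : ∑ k, X k k * O k k = O b b := by
      rw [hXb, Finset.sum_eq_single b (fun c _ hc => by simp [basisProj, Matrix.single, hc.symm])
        (by simp)]
      simp [basisProj]
    have hOb : ‖O b b‖ ≤ 1 := by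
      rw [hO.diag_eq_re b, Complex.norm_real, Real.norm_eq_abs, abs_of_nonneg (hO.diag_re_nonneg b),
        ← hO.sum_diag_re]
      exact Finset.single_le_sum (f := fun b => (O b b).re) (fun b _ => hO.diag_re_nonneg b)
        (Finset.mem_univ b)
    rw [h2, hXb, trace_mul_basisProj]
    have e : 2 * (dim n : ℂ) * (O b b - (dim n - 1) / dim n * O b b) - 1 / dim n
        = 2 * O b b - 1 / dim n := by field_simp; ring
    rw [e]
    refine (norm_sub_le _ _).trans ?_
    have h3 : ‖(1 / dim n : ℂ)‖ ≤ 1 := by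
      rw [norm_div, norm_one, Complex.norm_real, Real.norm_eq_abs, abs_of_pos hdpos]
      exact (div_le_one hdpos).2 hd1
    have h4 : ‖2 * O b b‖ ≤ 2 := by
      rw [norm_mul, Complex.norm_ofNat]; linarith
    linarith
  · have hflat : ∀ x, ‖(U i : Op n) b x‖ ^ 2 = 1 / dim n := by
      intro x
      have := hU.2 i 0 hi b x
      rwa [hU.1, OneMemClass.coe_one, star_one, mul_one] at this
    have hnorm : ∀ x y, ‖X x y‖ = 1 / dim n := by
      intro x y
      have h2 : ‖(U i : Op n) b x‖ = ‖(U i : Op n) b y‖ :=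
        (sq_eq_sq₀ (norm_nonneg _) (norm_nonneg _)).1 ((hflat x).trans (hflat y).symm)
      rw [hXapp, norm_mul, norm_star, h2, ← sq, hflat]
    have hdiag : ∀ x, X x x = 1 / dim n := by
      intro x
      rw [hXapp, Complex.star_def, ← Complex.normSq_eq_conj_mul_self, Complex.normSq_eq_norm_sq,
        hflat]
      push_cast
      rfl
    have h2 : ∑ k, X k k * O k k = 1 / dim n := by
      have h3 : ∑ k, O k k = 1 := hO.2
      simp only [hdiag, ← Finset.mul_sum, h3, mul_one]
    have h3 : ‖(O * X).trace‖ ≤ 2 / dim n := by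
      have := norm_trace_ketBra_pairVec_mul_le hc j k X
      simp only [hnorm] at this
      refine this.trans (le_of_eq ?_)
      ring
    rw [h2]
    have e : 2 * (dim n : ℂ) * ((O * X).trace - (dim n - 1) / dim n * (1 / dim n)) - 1 / dim n
        = ((2 * dim n : ℝ) : ℂ) * (O * X).trace - ((2 - 1 / dim n : ℝ) : ℂ) := by
      push_cast
      field_simp
      ring
    rw [e]
    refine (norm_sub_le _ _).trans ?_
    rw [norm_mul, Complex.norm_real, Complex.norm_real, Real.norm_eq_abs, Real.norm_eq_abs,
      abs_of_pos (by positivity)]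
    have h4 : 2 * dim n * ‖(O * X).trace‖ ≤ 2 * dim n * (2 / dim n) :=
      mul_le_mul_of_nonneg_left h3 (by positivity)
    have h5 : 2 * dim n * (2 / dim n) = 4 := by field_simp; norm_num
    have h6 : 1 / dim n ≤ 1 := (div_le_one hdpos).2 hd1
    have h7 : 0 < 1 / dim n := by positivity
    have h8 : |2 - 1 / dim n| ≤ 3 := abs_le.2 ⟨by linarith, by linarith⟩
    linarith

/-- The snapshots of biased measurements of mutually unbiased bases estimate pair states without
bias and with bounded second moment. -/
theorem IsCompleteMUB.isShadow_mubScheme (hU : IsCompleteMUB U) :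
    (mubScheme U).IsShadow 80 where
  weight_nonneg := weight_nonneg_mubScheme
  sum_weight := sum_weight_mubScheme
  evolve_density i ρ hρ := hρ.conjStarAlgAut (U i)
  mean_eq ρ hρ c hc j k hjk := by
    have h := congrArg Complex.re
      (hU.sum_mul_trace_snapshot hρ.2 (trace_ketBra_pairVec hc hjk))
    rw [← h, Complex.re_sum]
    refine Finset.sum_congr rfl fun i _ => ?_
    rw [Complex.re_ofReal_mul, Complex.re_sum, Finset.mul_sum]
    refine Finset.sum_congr rfl fun b _ => ?_
    rw [(hρ.conjStarAlgAut (U i)).diag_eq_re b, Complex.re_ofReal_mul, mul_assoc]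
    rfl
  second_le ρ hρ c hc j k hjk := by
    have hden : ∀ i, IsDensity ((mubScheme U).evolve i ρ) := fun i => hρ.conjStarAlgAut (U i)
    have h1 : ∑ i, ∑ b, (mubScheme U).weight i * ((mubScheme U).evolve i ρ b b).re * 80 = 80 := by
      simp only [← Finset.sum_mul, ← Finset.mul_sum, (hden _).sum_diag_re, mul_one,
        sum_weight_mubScheme, one_mul]
    refine (Finset.sum_le_sum fun i _ => Finset.sum_le_sum fun b _ => ?_).trans h1.le
    refine mul_le_mul_of_nonneg_left ?_
      (mul_nonneg (weight_nonneg_mubScheme i) ((hden i).diag_re_nonneg b))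
    have h2 := hU.abs_trace_mul_snapshot_le hc hjk i b
    rw [← sq_abs]
    nlinarith [abs_nonneg (ketBra (pairVec c j k) * snapshot (mubScheme U) (i, b)).trace.re]

end MUB

/-! ### The number of copies -/

theorem half_le_log_div {n : ℕ} (hn : 1 ≤ n) {δ : ℝ} (hδ : 0 < δ) (hδ1 : δ < 1) :
    1 / 2 ≤ Real.log (dim n / δ) := by
  have h1 : 2 ≤ dim n / δ := by
    rw [le_div_iff₀ hδ]
    linarith [two_le_dim hn]
  have h2 := Real.log_le_log (by norm_num) h1
  linarith [Real.log_two_gt_d9]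

/-- `N` frequencies, `2 K + 1` batches and batch size `m` of the order `log(d/δ) / η²`, `log(d/δ)`
and `1 / η²`, where `η = ε / (2 d^(3/2))`, suffice for the union bound. -/
theorem exists_tomographyFrom {n : ℕ} (hn : 1 ≤ n) {ε δ : ℝ} (hε : 0 < ε) (hε1 : ε ≤ 1)
    (hδ : 0 < δ) (hδ1 : δ < 1) :
    ∃ N K m : ℕ,
      ((N + (2 * K + 1) * m : ℕ) : ℝ)
        ≤ 80000 * (dim n ^ 3 * Real.log (dim n / δ) / ε ^ 2) ∧
      TomographyFrom n ε δ N K m := by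
  have hd := two_le_dim hn
  have hdpos := dim_pos n
  set d := dim n
  set L := Real.log (d / δ) with hL
  have hLhalf : 1 / 2 ≤ L := half_le_log_div hn hδ hδ1
  set η := ε / (2 * d ^ (3 / 2 : ℝ)) with hη
  have hηpos : 0 < η := by positivity
  have hη2 : η ^ 2 = ε ^ 2 / (4 * d ^ 3) := by
    have e : (d ^ (3 / 2 : ℝ)) ^ 2 = d ^ 3 := by
      rw [← Real.rpow_natCast, ← Real.rpow_mul hdpos.le, ← Real.rpow_natCast]; norm_num
    rw [hη, div_pow, mul_pow, e]; norm_num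
  set Q := d ^ 3 / ε ^ 2 with hQ
  have hηQ : η ^ 2 * Q = 1 / 4 := by rw [hη2, hQ]; field_simp
  have hQ1 : 1 ≤ Q := by
    rw [hQ, le_div_iff₀ (by positivity), one_mul]
    have h1 : ε ^ 2 ≤ 1 := pow_le_one₀ hε.le hε1
    have h2 : (1 : ℝ) ≤ d ^ 3 := one_le_pow₀ (by linarith)
    linarith
  have hexpL : Real.exp (-L) = δ / d := by
    rw [Real.exp_neg, hL, Real.exp_log (by positivity), inv_div]
  have hmlt := Nat.ceil_lt_add_one (a := 5120 * Q) (by positivity)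
  have hmle := Nat.le_ceil (5120 * Q)
  have hKlt := Nat.ceil_lt_add_one (a := 4 * L) (by linarith)
  have hKle := Nat.le_ceil (4 * L)
  have hNlt := Nat.ceil_lt_add_one (a := 6 * L * Q) (by positivity)
  have hNle := Nat.le_ceil (6 * L * Q)
  -- `5120 Q = 16 * 80 / η²`; the lower bounds on `K` and `N` make each half of the union bound
  -- at most `δ / 2`
  set m := ⌈5120 * Q⌉₊
  set K := ⌈4 * L⌉₊
  set N := ⌈6 * L * Q⌉₊
  have hLQ : 1 / 2 ≤ L * Q := by nlinarith
  have hm : 0 < m := by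
    have : (0 : ℝ) < m := by linarith
    exact_mod_cast this
  have hN : 0 < N := by
    have : (0 : ℝ) < N := by linarith
    exact_mod_cast this
  have hmB : 16 * (80 : ℝ) ≤ m * η ^ 2 := by
    have := mul_le_mul_of_nonneg_right hmle (sq_nonneg η)
    have e : 5120 * Q * η ^ 2 = 16 * 80 := by linear_combination 5120 * hηQ
    linarith
  have hfreq : d * (2 * Real.exp (-(2 * N * η ^ 2))) ≤ δ / 2 := by
    have h1 : 3 * L ≤ 2 * N * η ^ 2 := by
      have := mul_le_mul_of_nonneg_right hNle (sq_nonneg η)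
      have e : 6 * L * Q * η ^ 2 = 3 / 2 * L := by linear_combination 6 * L * hηQ
      linarith
    have h2 : Real.exp (-(2 * N * η ^ 2)) ≤ (δ / d) ^ 3 := by
      rw [← hexpL, ← Real.exp_nat_mul]
      exact Real.exp_le_exp.2 (by push_cast; linarith)
    have h3 : (δ / d) ^ 3 ≤ δ / (4 * d) := by
      rw [div_pow, div_le_div_iff₀ (by positivity) (by positivity)]
      have h4 : δ ^ 3 ≤ δ := by
        have : δ ^ 2 ≤ 1 := pow_le_one₀ hδ.le hδ1.le
        nlinarith
      have h5 : 4 * d ≤ d ^ 3 := by nlinarith [mul_self_nonneg (d - 2)]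
      exact mul_le_mul h4 h5 (by positivity) hδ.le
    have h6 := h2.trans h3
    calc d * (2 * Real.exp (-(2 * N * η ^ 2))) ≤ d * (2 * (δ / (4 * d))) := by gcongr
      _ = δ / 2 := by field_simp; norm_num
  have hmed : d ^ 2 * (2 * (1 / 4) ^ K) ≤ δ / 2 := by
    have h1 : ((1 : ℝ) / 4) ^ K ≤ (δ / d) ^ 4 := by
      have h2 : (1 / 4 : ℝ) ≤ Real.exp (-1) := by
        rw [Real.exp_neg, one_div]
        exact inv_anti₀ (Real.exp_pos _) (by linarith [Real.exp_one_lt_d9])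
      calc ((1 : ℝ) / 4) ^ K ≤ Real.exp (-1) ^ K := pow_le_pow_left₀ (by norm_num) h2 _
        _ = Real.exp (-K) := by rw [← Real.exp_nat_mul]; ring_nf
        _ ≤ Real.exp ((4 : ℕ) * -L) := Real.exp_le_exp.2 (by push_cast; linarith)
        _ = (δ / d) ^ 4 := by rw [Real.exp_nat_mul, hexpL]
    have h3 : (δ / d) ^ 4 ≤ δ / (4 * d ^ 2) := by
      rw [div_pow, div_le_div_iff₀ (by positivity) (by positivity)]
      have h4 : δ ^ 4 ≤ δ := by
        have : δ ^ 3 ≤ 1 := pow_le_one₀ hδ.le hδ1.le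
        nlinarith
      have h5 : 4 * d ^ 2 ≤ d ^ 4 := by
        have h6 : 4 ≤ d ^ 2 := by nlinarith
        linarith [mul_le_mul_of_nonneg_right h6 (sq_nonneg d)]
      exact mul_le_mul h4 h5 (by positivity) hδ.le
    have h6 := h1.trans h3
    calc d ^ 2 * (2 * (1 / 4) ^ K) ≤ d ^ 2 * (2 * (δ / (4 * d ^ 2))) := by gcongr
      _ = δ / 2 := by field_simp; norm_num
  have hfail : d * (2 * Real.exp (-(2 * N * η ^ 2))) + d ^ 2 * (2 * (1 / 4) ^ K) ≤ δ := by linarith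
  refine ⟨N, K, m, ?_, ?_, fun U hU => ?_⟩
  · have h1 : (m : ℝ) ≤ 5121 * Q := by linarith
    have h2 : 2 * (K : ℝ) + 1 ≤ 14 * L := by linarith
    have h3 : (2 * (K : ℝ) + 1) * m ≤ 14 * L * (5121 * Q) :=
      mul_le_mul h2 h1 (Nat.cast_nonneg _) (by linarith)
    have h4 : d ^ 3 * L / ε ^ 2 = L * Q := by rw [hQ]; ring
    rw [h4]
    push_cast
    linarith
  · exact (isShadow_cliffordScheme hn).succeeds hηpos hη hN hm hmB hfail
  · exact hU.isShadow_mubScheme.succeeds hηpos hη hN hm hmB hfail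

end DMPST

end

theorem theorem3 :
    -- entrywise error at most `2 ε / d^(3/2)` gives trace distance at most `ε`
    (∀ (d : ℕ) (ρ ρ' : Matrix (Fin d) (Fin d) ℂ) (ε ε₁ : ℝ), DMPST.IsDensity ρ →
      (∀ j k, ‖ρ' j k - ρ j k‖ ≤ ε₁) → ε₁ ≤ 2 * ε / (d : ℝ) ^ (3 / 2 : ℝ) →
      DMPST.traceDist ρ ρ' ≤ ε) ∧
    -- `O(d³ log (d / δ) / ε²)` copies suffice, with an absolute constant
    (∃ C : ℝ, 0 < C ∧ ∀ n : ℕ, 1 ≤ n → ∀ ε δ : ℝ, 0 < ε → ε ≤ 1 → 0 < δ → δ < 1 →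
      ∃ N K m : ℕ,
        ((N + (2 * K + 1) * m : ℕ) : ℝ)
          ≤ C * (DMPST.dim n ^ 3 * Real.log (DMPST.dim n / δ) / ε ^ 2) ∧
        DMPST.TomographyFrom n ε δ N K m) ∧
    -- in particular `O(d³ log d / ε²)` copies suffice for each fixed failure probability
    (∀ δ : ℝ, 0 < δ → δ < 1 → ∃ C : ℝ, 0 < C ∧ ∀ n : ℕ, 1 ≤ n → ∀ ε : ℝ, 0 < ε → ε ≤ 1 →
      ∃ N K m : ℕ,
        ((N + (2 * K + 1) * m : ℕ) : ℝ)
          ≤ C * (DMPST.dim n ^ 3 * Real.log (DMPST.dim n) / ε ^ 2) ∧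
        DMPST.TomographyFrom n ε δ N K m) := by
  refine ⟨fun d ρ ρ' ε ε₁ hρ h hε => ?_, ⟨80000, by norm_num, fun n hn ε δ hε hε1 hδ hδ1 =>
    DMPST.exists_tomographyFrom hn hε hε1 hδ hδ1⟩, fun δ hδ hδ1 => ?_⟩
  · -- a density matrix has trace one, so it is not of size zero
    have hne : Nonempty (Fin d) := by
      rcases isEmpty_or_nonempty (Fin d) with h0 | h0
      · have := hρ.2
        simp [Matrix.trace] at this
      · exact h0
    exact DMPST.traceDist_le_of_entry_le_div ρ ρ' h (by simpa using hε)
  · have hlog2 : 0 < Real.log 2 := Real.log_pos (by norm_num)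
    have hlogδ : 0 ≤ -Real.log δ := neg_nonneg.2 (Real.log_nonpos hδ.le hδ1.le)
    refine ⟨80000 * (1 + -Real.log δ / Real.log 2), by positivity, fun n hn ε hε hε1 => ?_⟩
    obtain ⟨N, K, m, h, hT⟩ := DMPST.exists_tomographyFrom hn hε hε1 hδ hδ1
    refine ⟨N, K, m, h.trans ?_, hT⟩
    have hdpos := DMPST.dim_pos n
    have hlogd : Real.log 2 ≤ Real.log (DMPST.dim n) :=
      Real.log_le_log (by norm_num) (DMPST.two_le_dim hn)
    have h1 : Real.log (DMPST.dim n / δ)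
        ≤ (1 + -Real.log δ / Real.log 2) * Real.log (DMPST.dim n) := by
      rw [Real.log_div hdpos.ne' hδ.ne']
      have h2 : -Real.log δ / Real.log 2 * Real.log 2
          ≤ -Real.log δ / Real.log 2 * Real.log (DMPST.dim n) :=
        mul_le_mul_of_nonneg_left hlogd (by positivity)
      rw [div_mul_cancel₀ _ hlog2.ne'] at h2
      linarith
    rw [mul_assoc]
    refine mul_le_mul_of_nonneg_left ?_ (by norm_num)
    rw [← mul_div_assoc]
    refine div_le_div_of_nonneg_right ?_ (by positivity)
    calc _ ≤ DMPST.dim n ^ 3 * ((1 + -Real.log δ / Real.log 2) * Real.log (DMPST.dim n)) :=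
          mul_le_mul_of_nonneg_left h1 (by positivity)
      _ = _ := by ring
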